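/- **Setting.** Let $\mathcal G$ be a finite network: a finite directed graph with vertex set $\mathsf V$ and nonempty edge set $\mathsf E$ (loops and multiple edges allowed), in which every edge $\mathsf e$ is identified with an interval $(0,\ell_{\mathsf e})$, $\ell_{\mathsf e}>0$, where $0$ corresponds to the initial and $\ell_{\mathsf e}$ to the terminal endpoint of $\mathsf e$. Let $k_{\mathsf e}\ge 1$ be integers and $k:=\sum_{\mathsf e}k_{\mathsf e}$. For every $\mathsf e$ let (1) $M_{\mathsf e}:[0,\ell_{\mathsf e}]\to\mathbb C^{k_{\mathsf e}\times k_{\mathsf e}}$ be Lipschitz continuous with $M_{\mathsf e}(x)$ invertible for all $x\in[0,\ell_{\mathsf e}]$; (2) $N_{\mathsf e}\in L^\infty(0,\ell_{\mathsf e};\mathbb C^{k_{\mathsf e}\times k_{\mathsf e}})$; (3) $Q_{\mathsf e}:[0,\ell_{\mathsf e}]\to\mathbb C^{k_{\mathsf e}\times k_{\mathsf e}}$ be Lipschitz continuous with $Q_{\mathsf e}(x)$ and $Q_{\mathsf e}(x)M_{\mathsf e}(x)$ Hermitian for all $x$, and such that for some $q>0$ one has $Q_{\mathsf e}(x)\xi\cdot\bar\xi\ge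 q\|\xi\|^2$ for all $x\in[0,\ell_{\mathsf e}]$ and $\xi\in\mathbb C^{k_{\mathsf e}}$. Let $\mathbf L^2(\mathcal G):=\bigoplus_{\mathsf e}L^2(0,\ell_{\mathsf e})^{k_{\mathsf e}}$ with the inner product $(u,v):=\sum_{\mathsf e}\int_0^{\ell_{\mathsf e}}Q_{\mathsf e}u_{\mathsf e}\cdot\bar v_{\mathsf e}\,dx$, which is equivalent to the canonical one. For a vertex $\mathsf v$ let $\mathsf E_{\mathsf v}$ be the set of the edges incident in $\mathsf v$, where a loop at $\mathsf v$ is listed twice, once for each of its ends, and let $k_{\mathsf v}:=\sum_{\mathsf e\in\mathsf E_{\mathsf v}}k_{\mathsf e}$. For $u\in\bigoplus_{\mathsf e}H^1(0,\ell_{\mathsf e})^{k_{\mathsf e}}$ let $\gamma_{\mathsf v}(u):=(u_{\mathsf e}(\mathsf v))_{\mathsf e\in\mathsf E_{\mathsf v}}\in\mathbb C^{k_{\mathsf v}}$ be the vector of the boundary values at $\mathsf v$. Let $T_{\mathsf v}$ be the block-diagonal $k_{\mathsf v}\times k_{\mathsf v}$ matrix with the blocks $\iota_{\mathsf v\mathsf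 e}Q_{\mathsf e}(\mathsf v)M_{\mathsf e}(\mathsf v)$, $\mathsf e\in\mathsf E_{\mathsf v}$, where $\iota_{\mathsf v\mathsf e}=-1$ at the initial end and $\iota_{\mathsf v\mathsf e}=+1$ at the terminal end of $\mathsf e$, and let $q_{\mathsf v}(\xi):=T_{\mathsf v}\xi\cdot\bar\xi$ for $\xi\in\mathbb C^{k_{\mathsf v}}$. For every $\mathsf v$ let $Y_{\mathsf v}$ be a linear subspace of $\mathbb C^{k_{\mathsf v}}$ and let $Y_{\mathsf v}^\perp$ be its orthogonal complement in $\mathbb C^{k_{\mathsf v}}$. Let $\widetilde{Y_{\mathsf v}^\perp}\subset\mathbb C^k$ be the image of $Y_{\mathsf v}^\perp$ under the map $\xi\mapsto\widetilde\xi$ that extends $\xi=(\xi_{\mathsf e})_{\mathsf e\in\mathsf E_{\mathsf v}}$ by $0$ to the edges that are not incident in $\mathsf v$ (for a loop at $\mathsf v$ the two components are added). **Theorem.** Suppose that each $Y_{\mathsf v}$, $\mathsf v\in\mathsf V$, is totally isotropic for $q_{\mathsf v}$, i.e. $q_{\mathsf v}(\xi)=0$ for all $\xi\in Y_{\mathsf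 v}$, and that $$\dim\sum_{\mathsf v\in\mathsf V}\widetilde{Y_{\mathsf v}^\perp}=k=\sum_{\mathsf v\in\mathsf V}\dim Y_{\mathsf v}.$$ Let $\mathcal A$ be the operator in $\mathbf L^2(\mathcal G)$ given by $(\mathcal Au)_{\mathsf e}:=M_{\mathsf e}u_{\mathsf e}'+N_{\mathsf e}u_{\mathsf e}$ on $$D(\mathcal A):=\Big\{u\in\bigoplus_{\mathsf e\in\mathsf E}H^1(0,\ell_{\mathsf e})^{k_{\mathsf e}}:\ \gamma_{\mathsf v}(u)\in Y_{\mathsf v}\text{ for all }\mathsf v\in\mathsf V\Big\}.$$ Then both $\mathcal A$ and $-\mathcal A$ are quasi-$m$-dissipative with respect to $(\cdot,\cdot)$, i.e. for some $\omega\in\mathbb R$ the operator $\pm\mathcal A-\omega$ is dissipative and $\mu-(\pm\mathcal A-\omega)$ is surjective for all $\mu>0$. In particular, both $\pm\mathcal A$ generate a strongly continuous semigroup, and $\mathcal A$ generates a strongly continuous group, on $\mathbf L^2(\mathcal G)$. Moreover, $\mathcal A$ has compact resolvent (its resolvent set is nonempty and all its resolvents are compact), and hence pure point spectrum: its spectrum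 consists of eigenvalues. -/

import Mathlib

open MeasureTheory Set Filter Topology
open scoped ENNReal NNReal ContDiff Matrix Matrix.Norms.L2Operator

noncomputable section

namespace HypNet

/-! ### Finite networks -/

/-- A network (metric graph) with vertex set `V` and edge set `E`: every edge is directed from its
initial to its terminal endpoint and is identified with the interval `(0, len e)`, parametrized
along the orientation. Loops and multiple edges are allowed. -/
structure Network (V E : Type*) where
  initial : E → V
  terminal : E → V
  len : E → ℝ
  len_pos : ∀ e, 0 < len e

namespace Network

variable {V E : Type*} (G : Network V E)

/-- The endpoint of `e` at one of its two ends: `false` is the initial end (`x = 0`), and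
`true` is the terminal end (`x = len e`). -/
def endpoint (e : E) : Bool → V
  | false => G.initial e
  | true => G.terminal e

/-- The coordinate in `[0, len e]` of an end of `e`. -/
def coord (e : E) : Bool → ℝ
  | false => 0
  | true => G.len e

/-- The ends of edges incident in `v`. For a network without loops this is the set `E_v` of the
edges incident in `v`; a loop at `v` is incident in `v` with both of its ends. -/
abbrev Incident (v : V) : Type _ := {p : E × Bool // G.endpoint p.1 p.2 = v}

variable {G}

namespace Incident

variable {v : V} (h : G.Incident v)

/-- The edge. -/
abbrev edge : E := h.1.1

/-- The coordinate of `v` on the edge. -/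
def pt : ℝ := G.coord h.1.1 h.1.2

/-- The entry `ι_{ve}` of the incidence matrix: `-1` at the initial end and `+1` at the
terminal end of the edge. -/
def sign : ℂ := if h.1.2 then 1 else -1

end Incident

end Network

/-- `ℂ^k` for one edge, with the Euclidean norm. -/
abbrev EdgeVec (k : ℕ) : Type := EuclideanSpace ℂ (Fin k)

/-- Lebesgue measure on `(0, ℓ)`. -/
abbrev edgeMeasure (ℓ : ℝ) : Measure ℝ := volume.restrict (Ioo 0 ℓ)

/-- `L²(0, ℓ)^k`. -/
abbrev EdgeL2 (ℓ : ℝ) (k : ℕ) : Type := Lp (EdgeVec k) 2 (edgeMeasure ℓ)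

/-! ### Weak derivatives, the space `H¹(0, ℓ)^k` and boundary values -/

/-- `g` is the weak (distributional) derivative of `u` on `(0, ℓ)`. -/
def HasWeakDeriv {F : Type*} [NormedAddCommGroup F] [NormedSpace ℝ F]
    (ℓ : ℝ) (u g : ℝ → F) : Prop :=
  ∀ φ : ℝ → ℝ, ContDiff ℝ ∞ φ → HasCompactSupport φ → tsupport φ ⊆ Ioo 0 ℓ →
    ∫ x in Ioo 0 ℓ, deriv φ x • u x = -∫ x in Ioo 0 ℓ, φ x • g x

section WeakDeriv

variable {ℓ : ℝ} {k : ℕ}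

theorem integrable_test_smul (u : EdgeL2 ℓ k) {φ : ℝ → ℝ} (hc : Continuous φ)
    (hs : HasCompactSupport φ) : Integrable (fun x => φ x • u x) (edgeMeasure ℓ) := by
  obtain ⟨C, hC⟩ := hs.exists_bound_of_continuous hc
  have hu : Integrable u (edgeMeasure ℓ) := (Lp.memLp u).integrable (by norm_num)
  exact hu.bdd_smul C hc.aestronglyMeasurable (Eventually.of_forall hC)

theorem continuous_deriv_test {φ : ℝ → ℝ} (h : ContDiff ℝ ∞ φ) : Continuous (deriv φ) :=
  h.continuous_deriv (by simp)

theorem hasWeakDeriv_zero : HasWeakDeriv ℓ (0 : EdgeL2 ℓ k) (0 : EdgeL2 ℓ k) := by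
  intro φ _ _ _
  have h0 : ((0 : EdgeL2 ℓ k) : ℝ → EdgeVec k) =ᵐ[edgeMeasure ℓ] 0 := Lp.coeFn_zero _ _ _
  have e (ψ : ℝ → ℝ) : ∫ x in Ioo 0 ℓ, ψ x • (0 : EdgeL2 ℓ k) x = 0 := by
    refine integral_eq_zero_of_ae ?_
    filter_upwards [h0] with x hx
    rw [hx]
    exact smul_zero _
  rw [e, e, neg_zero]

theorem hasWeakDeriv_add {u v g h : EdgeL2 ℓ k} (hu : HasWeakDeriv ℓ u g)
    (hv : HasWeakDeriv ℓ v h) :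
    HasWeakDeriv ℓ (u + v : EdgeL2 ℓ k) (g + h : EdgeL2 ℓ k) := by
  intro φ h1 h2 h3
  have e1 : ∫ x in Ioo 0 ℓ, deriv φ x • (u + v : EdgeL2 ℓ k) x
      = ∫ x in Ioo 0 ℓ, (deriv φ x • u x + deriv φ x • v x) :=
    integral_congr_ae (by filter_upwards [Lp.coeFn_add u v] with x hx; rw [hx, Pi.add_apply, smul_add])
  have e2 : ∫ x in Ioo 0 ℓ, φ x • (g + h : EdgeL2 ℓ k) x
      = ∫ x in Ioo 0 ℓ, (φ x • g x + φ x • h x) :=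
    integral_congr_ae (by filter_upwards [Lp.coeFn_add g h] with x hx; rw [hx, Pi.add_apply, smul_add])
  rw [e1, e2,
    integral_add (integrable_test_smul u (continuous_deriv_test h1) h2.deriv)
      (integrable_test_smul v (continuous_deriv_test h1) h2.deriv),
    integral_add (integrable_test_smul g h1.continuous h2)
      (integrable_test_smul h h1.continuous h2), hu φ h1 h2 h3, hv φ h1 h2 h3, neg_add]

theorem hasWeakDeriv_smul (c : ℂ) {u g : EdgeL2 ℓ k} (hu : HasWeakDeriv ℓ u g) :
    HasWeakDeriv ℓ (c • u : EdgeL2 ℓ k) (c • g : EdgeL2 ℓ k) := by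
  intro φ h1 h2 h3
  have e1 : ∫ x in Ioo 0 ℓ, deriv φ x • (c • u : EdgeL2 ℓ k) x
      = ∫ x in Ioo 0 ℓ, c • (deriv φ x • u x) :=
    integral_congr_ae (by
      filter_upwards [Lp.coeFn_smul c u] with x hx; rw [hx, Pi.smul_apply, smul_comm])
  have e2 : ∫ x in Ioo 0 ℓ, φ x • (c • g : EdgeL2 ℓ k) x
      = ∫ x in Ioo 0 ℓ, c • (φ x • g x) :=
    integral_congr_ae (by
      filter_upwards [Lp.coeFn_smul c g] with x hx; rw [hx, Pi.smul_apply, smul_comm])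
  rw [e1, e2, integral_smul, integral_smul, hu φ h1 h2 h3, smul_neg]

/-- Weak derivatives are unique. -/
theorem hasWeakDeriv_unique {u g h : EdgeL2 ℓ k} (hg : HasWeakDeriv ℓ u g)
    (hh : HasWeakDeriv ℓ u h) : g = h := by
  have hgi : Integrable g (edgeMeasure ℓ) := (Lp.memLp g).integrable (by norm_num)
  have hhi : Integrable h (edgeMeasure ℓ) := (Lp.memLp h).integrable (by norm_num)
  have key : ∀ᵐ x ∂volume, x ∈ Ioo 0 ℓ → (fun x => g x - h x) x = 0 := by
    refine isOpen_Ioo.ae_eq_zero_of_integral_contDiff_smul_eq_zero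
      (IntegrableOn.locallyIntegrableOn (hgi.sub hhi)) ?_
    intro φ h1 h2 h3
    have hz : ∀ x, x ∉ Ioo 0 ℓ → φ x • (g x - h x) = 0 := by
      intro x hx
      rw [image_eq_zero_of_notMem_tsupport (fun hx' => hx (h3 hx')), zero_smul]
    rw [← setIntegral_eq_integral_of_forall_compl_eq_zero hz]
    simp only [smul_sub]
    rw [integral_sub (integrable_test_smul g h1.continuous h2)
      (integrable_test_smul h h1.continuous h2), sub_eq_zero]
    have a := hg φ h1 h2 h3
    have b := hh φ h1 h2 h3
    exact neg_injective (a.symm.trans b)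
  refine Lp.ext ((ae_restrict_iff' measurableSet_Ioo).2 ?_)
  filter_upwards [key] with x hx hxm
  exact sub_eq_zero.1 (hx hxm)

end WeakDeriv

/-- The Sobolev space `H¹(0, ℓ)^k`, as a subspace of `L²(0, ℓ)^k`. -/
def H1 (ℓ : ℝ) (k : ℕ) : Submodule ℂ (EdgeL2 ℓ k) where
  carrier := {u | ∃ g : EdgeL2 ℓ k, HasWeakDeriv ℓ u g}
  zero_mem' := ⟨0, hasWeakDeriv_zero⟩
  add_mem' := by
    rintro u v ⟨g, hg⟩ ⟨h, hh⟩
    exact ⟨g + h, hasWeakDeriv_add hg hh⟩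
  smul_mem' := by
    rintro c u ⟨g, hg⟩
    exact ⟨c • g, hasWeakDeriv_smul c hg⟩

/-- The weak derivative `u ↦ u'` from `H¹(0, ℓ)^k` to `L²(0, ℓ)^k`. -/
def weakDeriv (ℓ : ℝ) (k : ℕ) : H1 ℓ k →ₗ[ℂ] EdgeL2 ℓ k where
  toFun u := u.2.choose
  map_add' u v := hasWeakDeriv_unique (u + v).2.choose_spec
    (hasWeakDeriv_add u.2.choose_spec v.2.choose_spec)
  map_smul' c u := hasWeakDeriv_unique (c • u).2.choose_spec
    (hasWeakDeriv_smul c u.2.choose_spec)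

/-- `w` restricted to `[0, ℓ]` is the continuous representative of `u`. Every element of `H¹(0, ℓ)^k`
has one, and its values on `[0, ℓ]`, in particular at the endpoints, are determined by `u`. -/
def IsContRep {ℓ : ℝ} {k : ℕ} (u : EdgeL2 ℓ k) (w : ℝ → EdgeVec k) : Prop :=
  ContinuousOn w (Icc 0 ℓ) ∧ u =ᵐ[edgeMeasure ℓ] w

/-! ### Multiplication by a bounded matrix-valued function -/

section MulLp

variable {ℓ : ℝ} {k : ℕ}

theorem memLp_mulVec {A : ℝ → Matrix (Fin k) (Fin k) ℂ} (hA : MemLp A ∞ (edgeMeasure ℓ))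
    (u : EdgeL2 ℓ k) :
    MemLp (fun x => WithLp.toLp 2 (A x *ᵥ (u x).ofLp) : ℝ → EdgeVec k) 2 (edgeMeasure ℓ) := by
  have hm : AEStronglyMeasurable (fun x => WithLp.toLp 2 (A x *ᵥ (u x).ofLp) : ℝ → EdgeVec k)
      (edgeMeasure ℓ) := by
    have hc : Continuous (fun p : Matrix (Fin k) (Fin k) ℂ × EdgeVec k =>
        (WithLp.toLp 2 (p.1 *ᵥ p.2.ofLp) : EdgeVec k)) :=
      (PiLp.continuous_toLp 2 _).comp
        (continuous_fst.matrix_mulVec ((PiLp.continuous_ofLp 2 _).comp continuous_snd))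
    exact hc.comp_aestronglyMeasurable (hA.1.prodMk (Lp.aestronglyMeasurable u))
  have hb : MemLp (fun x => ‖A x‖ • ‖u x‖) 2 (edgeMeasure ℓ) :=
    MemLp.smul (p := ∞) (q := 2) (r := 2) (Lp.memLp u).norm hA.norm
  refine hb.mono hm (Eventually.of_forall fun x => ?_)
  have := Matrix.l2_opNorm_mulVec (A x) (u x)
  simpa using this

/-- The operator `u ↦ A u` on `L²(0, ℓ)^k`, for `A ∈ L^∞(0, ℓ; M_k(ℂ))`. -/
def mulLp (A : ℝ → Matrix (Fin k) (Fin k) ℂ) (hA : MemLp A ∞ (edgeMeasure ℓ)) :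
    EdgeL2 ℓ k →ₗ[ℂ] EdgeL2 ℓ k where
  toFun u := (memLp_mulVec hA u).toLp
  map_add' u v := by
    rw [← MemLp.toLp_add]
    refine MemLp.toLp_congr _ _ ?_
    filter_upwards [Lp.coeFn_add u v] with x hx
    rw [hx]
    simp only [Pi.add_apply, WithLp.ofLp_add, Matrix.mulVec_add, WithLp.toLp_add]
  map_smul' c u := by
    rw [RingHom.id_apply, ← MemLp.toLp_const_smul]
    refine MemLp.toLp_congr _ _ ?_
    filter_upwards [Lp.coeFn_smul c u] with x hx
    rw [hx]
    simp only [Pi.smul_apply, WithLp.ofLp_smul, Matrix.mulVec_smul, WithLp.toLp_smul]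

theorem memLp_top_of_lipschitz {A : ℝ → Matrix (Fin k) (Fin k) ℂ}
    (hA : ∃ K : ℝ≥0, LipschitzOnWith K A (Icc 0 ℓ)) : MemLp A ∞ (edgeMeasure ℓ) := by
  obtain ⟨K, hK⟩ := hA
  have hc : ContinuousOn A (Icc 0 ℓ) := hK.continuousOn
  obtain ⟨C, hC⟩ := isCompact_Icc.exists_bound_of_continuousOn hc
  refine memLp_top_of_bound
    ((hc.mono Ioo_subset_Icc_self).aestronglyMeasurable measurableSet_Ioo) C ?_
  refine (ae_restrict_iff' measurableSet_Ioo).2 (Eventually.of_forall fun x hx => ?_)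
  exact hC x (Ioo_subset_Icc_self hx)

end MulLp

/-! ### Hyperbolic systems on a network -/

/-- The coefficients `M_e`, `N_e` of the system `∂ₜ u_e = M_e u_e' + N_e u_e` on the edges, together
with the symmetrizers `Q_e`, under the standing assumptions. The matrix norm is the operator norm
that is induced by the Euclidean norm. -/
structure HypSystem {V E : Type*} (G : Network V E) (k : E → ℕ) where
  M : ∀ e, ℝ → Matrix (Fin (k e)) (Fin (k e)) ℂ
  N : ∀ e, ℝ → Matrix (Fin (k e)) (Fin (k e)) ℂ
  Q : ∀ e, ℝ → Matrix (Fin (k e)) (Fin (k e)) ℂ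
  M_isUnit : ∀ e, ∀ x ∈ Icc 0 (G.len e), IsUnit (M e x)
  M_lipschitz : ∀ e, ∃ K : ℝ≥0, LipschitzOnWith K (M e) (Icc 0 (G.len e))
  N_memLp : ∀ e, MemLp (N e) ∞ (edgeMeasure (G.len e))
  Q_lipschitz : ∀ e, ∃ K : ℝ≥0, LipschitzOnWith K (Q e) (Icc 0 (G.len e))
  Q_isHermitian : ∀ e, ∀ x ∈ Icc 0 (G.len e), (Q e x).IsHermitian
  QM_isHermitian : ∀ e, ∀ x ∈ Icc 0 (G.len e), (Q e x * M e x).IsHermitian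
  Q_pos : ∀ e, ∃ q : ℝ, 0 < q ∧ ∀ x ∈ Icc 0 (G.len e), ∀ ξ : EdgeVec (k e),
    q * ‖ξ‖ ^ 2 ≤ ((Q e x *ᵥ ξ.ofLp) ⬝ᵥ star ξ.ofLp).re

section Spaces

variable {V E : Type*} [Fintype E] (G : Network V E) (k : E → ℕ)

/-- The Hilbert space `⨁_e L²(0, ℓ_e)^{k_e}`, with its canonical norm. -/
abbrev L2G : Type _ := PiLp 2 (fun e : E => EdgeL2 (G.len e) (k e))

/-- `ℂ^k`, where `k = ∑_e k_e`; the coordinates are indexed by an edge `e` and `i < k_e`. -/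
abbrev TotalVec : Type _ := EuclideanSpace ℂ (Σ e : E, Fin (k e))

variable [DecidableEq V]

/-- `ℂ^{k_v}`, where `k_v` is the sum of the `k_e` over the edge ends incident in `v`. -/
abbrev VertexVec (v : V) : Type _ := EuclideanSpace ℂ (Σ h : G.Incident v, Fin (k h.edge))

/-- `(w_e(v))_e ∈ ℂ^{k_v}`, the values at `v` of functions `w_e` on the incident edges. -/
def vertexValues (w : ∀ e, ℝ → EdgeVec (k e)) (v : V) : VertexVec G k v :=
  WithLp.toLp 2 fun p => w p.1.edge p.1.pt p.2

/-- The map `ξ ↦ ξ̃` from `ℂ^{k_v}` to `ℂ^k`, extending by zero to the edges that are not incident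
in `v`. If `e` is a loop at `v`, then the two components of `ξ` that belong to `e` are added, so
that in all cases the scalar product of `(K_e)_e ∈ ℂ^k` with `ξ̃` is that of
`vertexValues G k (fun e _ => K e) v` with `ξ`. -/
def extendByZero (v : V) : VertexVec G k v →ₗ[ℂ] TotalVec k where
  toFun ξ := WithLp.toLp 2 fun p =>
    ∑ b : Bool, if h : G.endpoint p.1 b = v then ξ ⟨⟨(p.1, b), h⟩, p.2⟩ else 0
  map_add' ξ η := by
    ext p
    simp only [PiLp.add_apply, ← Finset.sum_add_distrib]
    refine Finset.sum_congr rfl fun b _ => ?_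
    split_ifs <;> simp
  map_smul' c ξ := by
    ext p
    simp only [PiLp.smul_apply, RingHom.id_apply, smul_eq_mul, Finset.mul_sum]
    refine Finset.sum_congr rfl fun b _ => ?_
    split_ifs <;> simp

end Spaces

namespace HypSystem

section Vertex

variable {V E : Type*} [Fintype E] [DecidableEq V] [DecidableEq E]
  {G : Network V E} {k : E → ℕ} (S : HypSystem G k)

/-- The block-diagonal matrix `T_v` with the blocks `ι_{ve} Q_e(v) M_e(v)`. -/
def T (v : V) : Matrix (Σ h : G.Incident v, Fin (k h.edge)) (Σ h : G.Incident v, Fin (k h.edge)) ℂ :=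
  Matrix.blockDiagonal' fun h : G.Incident v => h.sign • (S.Q h.edge h.pt * S.M h.edge h.pt)

/-- The quadratic form `q_v(ξ) = T_v ξ · ξ̄`. -/
def q (v : V) (ξ : VertexVec G k v) : ℂ := (S.T v *ᵥ ξ.ofLp) ⬝ᵥ star ξ.ofLp

/-- `Y` is a totally isotropic subspace associated with `q_v`. -/
def TotallyIsotropic (v : V) (Y : Submodule ℂ (VertexVec G k v)) : Prop := ∀ ξ ∈ Y, S.q v ξ = 0

end Vertex

section Operator

variable {V E : Type*} [Fintype E] {G : Network V E} {k : E → ℕ} (S : HypSystem G k)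

/-- The inner product `(u, v) = ∑_e ∫ Q_e u_e · v̄_e dx`, linear in `u`. -/
def energyInner (u v : L2G G k) : ℂ :=
  ∑ e, ∫ x in Ioo 0 (G.len e), (S.Q e x *ᵥ (u e x).ofLp) ⬝ᵥ star (v e x).ofLp

variable [DecidableEq V]

/-- The domain `D(𝒜) = {u ∈ ⨁_e H¹(0, ℓ_e)^{k_e} : γ_v(u) ∈ Y_v for all v}`, where the trace
`γ_v(u)` collects the values at `v` of the continuous representatives of the `u_e`. -/
def operatorDomain (G : Network V E) (k : E → ℕ) (Y : ∀ v, Submodule ℂ (VertexVec G k v)) :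
    Submodule ℂ (L2G G k) where
  carrier := {u | (∀ e, u e ∈ H1 (G.len e) (k e)) ∧
    ∃ w : ∀ e, ℝ → EdgeVec (k e), (∀ e, IsContRep (u e) (w e)) ∧ ∀ v, vertexValues G k w v ∈ Y v}
  zero_mem' := ⟨fun e => (H1 _ _).zero_mem, fun _ _ => 0,
    fun e => ⟨continuousOn_const, Lp.coeFn_zero _ _ _⟩, fun v => (Y v).zero_mem⟩
  add_mem' := by
    rintro u u' ⟨h1, w, h2, h3⟩ ⟨h1', w', h2', h3'⟩
    refine ⟨fun e => (H1 _ _).add_mem (h1 e) (h1' e), fun e => w e + w' e, fun e => ⟨?_, ?_⟩,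
      fun v => (Y v).add_mem (h3 v) (h3' v)⟩
    · exact (h2 e).1.add (h2' e).1
    · exact (Lp.coeFn_add (u e) (u' e)).trans ((h2 e).2.add (h2' e).2)
  smul_mem' := by
    rintro c u ⟨h1, w, h2, h3⟩
    refine ⟨fun e => (H1 _ _).smul_mem c (h1 e), fun e => c • w e, fun e => ⟨?_, ?_⟩,
      fun v => (Y v).smul_mem c (h3 v)⟩
    · exact (h2 e).1.const_smul c
    · exact (Lp.coeFn_smul c (u e)).trans ((h2 e).2.const_smul c)

/-- The operator `(𝒜 u)_e = M_e u_e' + N_e u_e` with domain `D(𝒜)`. -/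
def operator (Y : ∀ v, Submodule ℂ (VertexVec G k v)) : L2G G k →ₗ.[ℂ] L2G G k where
  domain := operatorDomain G k Y
  toFun :=
    { toFun := fun u => WithLp.toLp 2 fun e =>
        mulLp (S.M e) (memLp_top_of_lipschitz (S.M_lipschitz e))
            (weakDeriv (G.len e) (k e) ⟨u.1 e, u.2.1 e⟩)
          + mulLp (S.N e) (S.N_memLp e) (u.1 e)
      map_add' := by
        intro u v
        ext1 e
        have h : (⟨(u + v).1 e, (u + v).2.1 e⟩ : H1 (G.len e) (k e))
            = ⟨u.1 e, u.2.1 e⟩ + ⟨v.1 e, v.2.1 e⟩ := rfl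
        have h' : (u + v).1 e = u.1 e + v.1 e := rfl
        simp only [PiLp.add_apply]
        rw [h, h', map_add, map_add, map_add]
        abel
      map_smul' := by
        intro c u
        ext1 e
        have h : (⟨(c • u).1 e, (c • u).2.1 e⟩ : H1 (G.len e) (k e))
            = c • ⟨u.1 e, u.2.1 e⟩ := rfl
        have h' : (c • u).1 e = c • u.1 e := rfl
        simp only [PiLp.smul_apply, RingHom.id_apply]
        rw [h, h', map_smul, map_smul, map_smul, smul_add] }

end Operator

end HypSystem

/-! ### Operator theory -/

section OperatorTheory

variable {H : Type*} [NormedAddCommGroup H] [NormedSpace ℂ H]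

/-- `A` is quasi-m-dissipative with respect to the inner product `B` (linear in its first argument):
for some real `c` the operator `A - c` is dissipative, and `μ - (A - c)` is surjective for every
`μ > 0`. -/
def IsQuasiMDissipative (B : H → H → ℂ) (A : H →ₗ.[ℂ] H) : Prop :=
  ∃ c : ℝ, (∀ u : A.domain, (B (A u - (c : ℂ) • (u : H)) u).re ≤ 0) ∧
    ∀ μ : ℝ, 0 < μ → ∀ f : H, ∃ u : A.domain, (μ : ℂ) • (u : H) - (A u - (c : ℂ) • (u : H)) = f

/-- Strongly continuous semigroups of bounded operators. -/
structure IsC0Semigroup (T : ℝ≥0 → H →L[ℂ] H) : Prop where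
  map_zero : T 0 = ContinuousLinearMap.id ℂ H
  map_add : ∀ s t, T (s + t) = (T s).comp (T t)
  continuous_orbit : ∀ u, Continuous fun t => T t u

/-- Strongly continuous groups of bounded operators. -/
structure IsC0Group (T : ℝ → H →L[ℂ] H) : Prop where
  map_zero : T 0 = ContinuousLinearMap.id ℂ H
  map_add : ∀ s t, T (s + t) = (T s).comp (T t)
  continuous_orbit : ∀ u, Continuous fun t => T t u

/-- `A` is the generator of a strongly continuous semigroup `T`: `u ∈ D(A)` and `A u = f` if and
only if `(T t u - u) / t → f` as `t → 0+`. -/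
def GeneratesC0Semigroup (A : H →ₗ.[ℂ] H) : Prop :=
  ∃ T : ℝ≥0 → H →L[ℂ] H, IsC0Semigroup T ∧
    ∀ u f : H, (u, f) ∈ A.graph ↔
      Tendsto (fun t : ℝ≥0 => (((t : ℝ) : ℂ))⁻¹ • (T t u - u)) (𝓝[>] 0) (𝓝 f)

/-- `A` is the generator of a strongly continuous group `T`: `u ∈ D(A)` and `A u = f` if and
only if `(T t u - u) / t → f` as `t → 0`. -/
def GeneratesC0Group (A : H →ₗ.[ℂ] H) : Prop :=
  ∃ T : ℝ → H →L[ℂ] H, IsC0Group T ∧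
    ∀ u f : H, (u, f) ∈ A.graph ↔
      Tendsto (fun t : ℝ => (t : ℂ)⁻¹ • (T t u - u)) (𝓝[≠] 0) (𝓝 f)

/-- The bounded operator `R` is the resolvent `(μ - A)⁻¹`. -/
def IsResolventAt (A : H →ₗ.[ℂ] H) (μ : ℂ) (R : H →L[ℂ] H) : Prop :=
  (∀ f : H, ∃ u : A.domain, (u : H) = R f ∧ μ • (u : H) - A u = f) ∧
    ∀ u : A.domain, R (μ • (u : H) - A u) = u

/-- The resolvent set of `A`. -/
def resolventSet (A : H →ₗ.[ℂ] H) : Set ℂ := {μ | ∃ R, IsResolventAt A μ R}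

/-- The set of the eigenvalues of `A`. -/
def pointSpectrum (A : H →ₗ.[ℂ] H) : Set ℂ :=
  {μ | ∃ u : A.domain, (u : H) ≠ 0 ∧ A u = μ • (u : H)}

/-- The resolvent set of `A` is nonempty and all resolvents are compact operators. -/
def HasCompactResolvent (A : H →ₗ.[ℂ] H) : Prop :=
  (resolventSet A).Nonempty ∧ ∀ μ R, IsResolventAt A μ R → IsCompactOperator R

/-- The spectrum of `A` consists of eigenvalues. -/
def HasPurePointSpectrum (A : H →ₗ.[ℂ] H) : Prop := (resolventSet A)ᶜ = pointSpectrum A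

end OperatorTheory

end HypNet

end

/-!
Let `∂` be the weak derivative on the domain of `𝒜`, so that `𝒜 = M ∂ + N`.

*Invertibility of `∂`.* A function `u` with weak derivative `g` is `K_e + ∫₀ˣ g_e` on the edge `e`,
and the vertex conditions are linear equations for the initial values `K`. The homogeneous equations
say that the edgewise constant function `K` has its vertex values in `Y_v`; such a `K` is orthogonal
to the extensions by zero of all `Y_v^⊥`, which span `ℂ^k`, so `K = 0`. The second dimension
condition says that the number of equations is the number of unknowns, so `K` is uniquely determined
by the increments of `u` along the edges (`exists_initialValues`). Hence `∂` has an inverse on `L²`,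
the sum of a Volterra operator on every edge and an operator of finite rank (`networkPrimitive`). It
is compact, and so is the inverse of `M ∂ = 𝒜 - N`.

*Spectrum.* Since `𝒜` is a bounded perturbation of an operator with compact inverse, the Fredholm
alternative for compact operators shows that every `μ` which is not an eigenvalue of `𝒜` belongs to
the resolvent set (`mem_resolventSet_of_notMem_pointSpectrum`), and that all resolvents are compact
(`isCompactOperator_of_isResolventAt`).

*Energy estimate.* Integration by parts on the edges, where `Q M` is Hermitian and Lipschitz
continuous, expresses `2 Re (M ∂ u, u)` through `∑_v q_v(γ_v(u))` and a term that is bounded by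
`‖u‖²`. The boundary terms vanish by isotropy, so `|Re (𝒜 u, u)| ≤ c ‖u‖²` on the domain
(`HypSystem.exists_energy_le`). Consequently no real number of large modulus is an eigenvalue, all
of them belong to the resolvent set, and both `𝒜` and `-𝒜` are quasi-m-dissipative.

*Generation.* The group is the strong limit, as `l → ∞`, of the exponentials of the two-sided Yosida
approximations `𝒜 (1 - 𝒜 / l)⁻¹ (1 + 𝒜 / l)⁻¹`. These are bounded operators that inherit the
two-sided energy estimate, so their exponentials are bounded for positive and negative times,
uniformly in `l` (`energy_yosida_le`, `norm_exp_smul_le_of_energy`). That the domain is dense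
follows from the energy estimate as well (`dense_domain_of_energy`).
-/

noncomputable section

namespace HypNet

/-! ### Exponentials of bounded operators -/

section BoundedExp

open NormedSpace

variable {H : Type*} [NormedAddCommGroup H] [NormedSpace ℂ H] [CompleteSpace H]

theorem hasDerivAt_exp_smul_apply (B : H →L[ℂ] H) (u : H) (t : ℝ) :
    HasDerivAt (fun s : ℝ => exp (s • B) u) (exp (t • B) (B u)) t :=
  ((ContinuousLinearMap.apply ℂ H u).restrictScalars ℝ).hasFDerivAt.comp_hasDerivAt t
    (hasDerivAt_exp_smul_const (𝕂 := ℝ) B t)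

theorem exp_add_smul (B : H →L[ℂ] H) (s t : ℝ) :
    exp ((s + t) • B) = exp (s • B) * exp (t • B) := by
  let _ : NormedAlgebra ℚ (H →L[ℂ] H) := NormedAlgebra.restrictScalars ℚ ℝ _
  rw [add_smul]
  exact exp_add_of_commute (((Commute.refl B).smul_left s).smul_right t)

theorem norm_exp_smul_apply_sub_le (B : H →L[ℂ] H) (u : H) {t L : ℝ}
    (hL : ∀ s, |s| ≤ |t| → ‖exp (s • B)‖ ≤ L) : ‖exp (t • B) u - u‖ ≤ L * ‖B u‖ * |t| := by
  have h := Convex.norm_image_sub_le_of_norm_hasDerivWithin_le (𝕜 := ℝ)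
    (f := fun s : ℝ => exp (s • B) u) (f' := fun s => exp (s • B) (B u)) (s := {s | |s| ≤ |t|})
    (x := 0) (y := t) (C := L * ‖B u‖)
    (fun s _ => (hasDerivAt_exp_smul_apply B u s).hasDerivWithinAt)
    (fun s hs => (ContinuousLinearMap.le_opNorm _ _).trans
      (mul_le_mul_of_nonneg_right (hL s hs) (norm_nonneg _)))
    (by
      have : {s : ℝ | |s| ≤ |t|} = Icc (-|t|) |t| := by ext s; simp [abs_le]
      rw [this]; exact convex_Icc _ _)
    (by simp) (by simp)
  simpa using h

/-- For commuting generators, `exp (tX) - exp (tY) = exp (tY) (exp (t(X - Y)) - 1)`. -/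
theorem norm_exp_smul_sub_exp_smul_le {X Y : H →L[ℂ] H} (hXY : Commute X Y) (u : H) {t L : ℝ}
    (hX : ∀ s, |s| ≤ |t| → ‖exp (s • X)‖ ≤ L) (hY : ∀ s, |s| ≤ |t| → ‖exp (s • Y)‖ ≤ L) :
    ‖exp (t • X) u - exp (t • Y) u‖ ≤ L * (L * L * ‖X u - Y u‖ * |t|) := by
  let _ : NormedAlgebra ℚ (H →L[ℂ] H) := NormedAlgebra.restrictScalars ℚ ℝ _
  have hc : ∀ a b : ℝ, Commute (a • X) (b • Y) := fun a b => (hXY.smul_left a).smul_right b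
  have hL : 0 ≤ L := (norm_nonneg _).trans (hX 0 (by simp))
  have e1 : ∀ s : ℝ, exp (s • (X - Y)) = exp (s • X) * exp ((-s) • Y) := fun s => by
    rw [← exp_add_of_commute (hc _ _), smul_sub, neg_smul, sub_eq_add_neg]
  have e2 : exp (t • X) = exp (t • Y) * exp (t • (X - Y)) := by
    rw [← exp_add_of_commute (by
      rw [smul_sub]; exact ((hc t t).symm.sub_right (Commute.refl _)))]
    congr 1
    rw [smul_sub]; abel
  have e3 : exp (t • X) u - exp (t • Y) u = exp (t • Y) (exp (t • (X - Y)) u - u) := by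
    rw [e2, map_sub]; rfl
  have h1 := norm_exp_smul_apply_sub_le (X - Y) u (t := t) (L := L * L) (fun s hs => by
    rw [e1]
    refine (norm_mul_le _ _).trans (mul_le_mul (hX s hs) (hY _ (by simpa using hs))
      (norm_nonneg _) hL))
  rw [e3]
  exact (ContinuousLinearMap.le_opNorm _ _).trans
    (mul_le_mul (hY t le_rfl) h1 (norm_nonneg _) hL)

end BoundedExp

/-! ### Pointwise limits of uniformly bounded operators -/

section PointwiseLimits

variable {H : Type*} [NormedAddCommGroup H] [NormedSpace ℂ H]

/-- Pointwise convergence on a dense set extends to the whole space, for bounded sequences. -/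
theorem cauchySeq_of_dense {T : ℕ → H →L[ℂ] H} {C : ℝ} (hT : ∀ n, ‖T n‖ ≤ C) {D : Set H}
    (hD : Dense D) (h : ∀ u ∈ D, CauchySeq fun n => T n u) (u : H) :
    CauchySeq fun n => T n u := by
  have hC : 0 ≤ C := (norm_nonneg _).trans (hT 0)
  rw [Metric.cauchySeq_iff']
  intro ε hε
  obtain ⟨v, hv, huv⟩ := Metric.dense_iff.1 hD u (ε / (3 * (C + 1))) (by positivity)
  rw [Metric.mem_ball, dist_comm, dist_eq_norm] at hv
  have hb : ∀ n, ‖T n u - T n v‖ < ε / 3 := fun n => by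
    rw [← map_sub]
    calc ‖T n (u - v)‖ ≤ C * ‖u - v‖ := (T n).le_of_opNorm_le (hT n) _
      _ ≤ (C + 1) * ‖u - v‖ := by gcongr; linarith
      _ < (C + 1) * (ε / (3 * (C + 1))) := by gcongr
      _ = ε / 3 := by field_simp
  obtain ⟨N, hN⟩ := Metric.cauchySeq_iff'.1 (h v huv) (ε / 3) (by positivity)
  refine ⟨N, fun n hn => ?_⟩
  have h2 := hN n hn
  rw [dist_eq_norm] at h2 ⊢
  calc ‖T n u - T N u‖ = ‖(T n u - T n v) + (T n v - T N v) + -(T N u - T N v)‖ := by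
        congr 1; abel
    _ ≤ ‖T n u - T n v‖ + ‖T n v - T N v‖ + ‖T N u - T N v‖ := by
        refine (norm_add₃_le).trans ?_
        rw [norm_neg]
    _ < ε := by linarith [hb n, hb N]

theorem tendsto_self_of_dense {ι : Type*} {l : Filter ι} {T : ι → H →L[ℂ] H} {C : ℝ}
    (hC : 0 ≤ C) (hT : ∀ᶠ n in l, ‖T n‖ ≤ C) {D : Set H}
    (hD : Dense D) (h : ∀ u ∈ D, Tendsto (fun n => T n u) l (𝓝 u)) (u : H) :
    Tendsto (fun n => T n u) l (𝓝 u) := by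
  rw [Metric.tendsto_nhds]
  intro ε hε
  obtain ⟨v, hv, huv⟩ := Metric.dense_iff.1 hD u (ε / (3 * (C + 1))) (by positivity)
  rw [Metric.mem_ball, dist_comm, dist_eq_norm] at hv
  have h3 : ‖u - v‖ < ε / 3 := by
    refine hv.trans_le ?_
    gcongr
    linarith
  filter_upwards [Metric.tendsto_nhds.1 (h v huv) (ε / 3) (by positivity), hT] with n h2 hn
  have hb : ‖T n u - T n v‖ < ε / 3 := by
    rw [← map_sub]
    calc ‖T n (u - v)‖ ≤ C * ‖u - v‖ := (T n).le_of_opNorm_le hn _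
      _ ≤ (C + 1) * ‖u - v‖ := by gcongr; linarith
      _ < (C + 1) * (ε / (3 * (C + 1))) := by gcongr
      _ = ε / 3 := by field_simp
  rw [dist_eq_norm] at h2 ⊢
  calc ‖T n u - u‖ = ‖(T n u - T n v) + (T n v - v) + -(u - v)‖ := by
        congr 1; abel
    _ ≤ ‖T n u - T n v‖ + ‖T n v - v‖ + ‖u - v‖ := by
        refine (norm_add₃_le).trans ?_
        rw [norm_neg]
    _ < ε := by linarith

theorem tendsto_clm_apply_of_bounded {ι : Type*} {l : Filter ι} {T : ι → H →L[ℂ] H} {C : ℝ}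
    (hT : ∀ n, ‖T n‖ ≤ C) {u : ι → H} {v w : H} (hu : Tendsto u l (𝓝 v))
    (hv : Tendsto (fun n => T n v) l (𝓝 w)) : Tendsto (fun n => T n (u n)) l (𝓝 w) := by
  have h0 : Tendsto (fun n => T n (u n - v)) l (𝓝 0) := by
    refine squeeze_zero_norm (fun n => (T n).le_of_opNorm_le (hT n) _) ?_
    simpa using (tendsto_iff_norm_sub_tendsto_zero.1 hu).const_mul C
  simpa using h0.add hv

end PointwiseLimits

/-! ### Groups as limits of exponentials of bounded operators -/

section GroupLimit

open NormedSpace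

theorem cauchySeq_of_norm_sub_le {H : Type*} [NormedAddCommGroup H] {f g : ℕ → H} {K : ℝ}
    (hf : CauchySeq f)
    (h : ∀ n m, ‖g n - g m‖ ≤ K * ‖f n - f m‖) : CauchySeq g := by
  have hb := cauchySeq_iff_le_tendsto_0.1 hf
  obtain ⟨b, b0, hb, hlim⟩ := hb
  refine cauchySeq_iff_le_tendsto_0.2 ⟨fun n => |K| * b n, fun n => by have := b0 n; positivity,
    fun n m N hn hm => ?_, by simpa using hlim.const_mul |K|⟩
  rw [dist_eq_norm]
  refine (h n m).trans ?_
  have := hb n m N hn hm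
  rw [dist_eq_norm] at this
  exact mul_le_mul (le_abs_self K) this (norm_nonneg _) (abs_nonneg _)

variable {H : Type*} [NormedAddCommGroup H] [NormedSpace ℂ H] [CompleteSpace H]

/-- Let `B n` be commuting bounded operators whose exponentials are bounded locally uniformly in
time, uniformly in `n`, and assume that `B n` converges pointwise on a dense set. Then
`exp (t B n)` converges strongly to a strongly continuous group, whose derivative at `0` is the
pointwise limit of the `B n`, wherever this limit exists. -/
theorem exists_group_of_tendsto {B : ℕ → H →L[ℂ] H} (hcomm : ∀ n m, Commute (B n) (B m))
    {C a : ℝ} (ha : 0 ≤ a) (hexp : ∀ n (t : ℝ), ‖exp (t • B n)‖ ≤ C * Real.exp (a * |t|))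
    {D : Set H} (hD : Dense D) (hconv : ∀ u ∈ D, ∃ g, Tendsto (fun n => B n u) atTop (𝓝 g)) :
    ∃ T : ℝ → H →L[ℂ] H, IsC0Group T ∧
      (∀ t u, Tendsto (fun n => exp (t • B n) u) atTop (𝓝 (T t u))) ∧
      ∀ u g, Tendsto (fun n => B n u) atTop (𝓝 g) → HasDerivAt (fun t => T t u) g 0 := by
  have hC : 0 ≤ C := by
    have := (norm_nonneg _).trans (hexp 0 0)
    simpa using this
  have hexp' : ∀ n (t s : ℝ), |s| ≤ |t| → ‖exp (s • B n)‖ ≤ C * Real.exp (a * |t|) := by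
    intro n t s hs
    refine (hexp n s).trans ?_
    gcongr
  have hcau : ∀ (t : ℝ) (u : H), CauchySeq fun n => exp (t • B n) u := by
    intro t
    refine cauchySeq_of_dense (hexp · t) hD fun u hu => ?_
    obtain ⟨g, hg⟩ := hconv u hu
    set L := C * Real.exp (a * |t|)
    refine cauchySeq_of_norm_sub_le (K := L * (L * L * |t|)) hg.cauchySeq fun n m => ?_
    refine (norm_exp_smul_sub_exp_smul_le (hcomm n m) u (hexp' n t) (hexp' m t)).trans
      (le_of_eq ?_)
    ring
  choose F hF using fun t u => cauchySeq_tendsto_of_complete (hcau t u)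
  let T : ℝ → H →L[ℂ] H := fun t =>
    continuousLinearMapOfTendsto (fun n => exp (t • B n)) (tendsto_pi_nhds.2 (hF t))
  have hT : ∀ t u, Tendsto (fun n => exp (t • B n) u) atTop (𝓝 (T t u)) := hF
  have hTb : ∀ t, ‖T t‖ ≤ C * Real.exp (a * |t|) := fun t =>
    ContinuousLinearMap.opNorm_le_bound _ (by positivity) fun u =>
      le_of_tendsto (hT t u).norm (Eventually.of_forall fun n =>
        (exp (t • B n)).le_of_opNorm_le (hexp n t) u)
  have hT0 : T 0 = ContinuousLinearMap.id ℂ H := by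
    ext u
    refine tendsto_nhds_unique (hT 0 u) ?_
    simp
  have hTadd : ∀ s t, T (s + t) = (T s).comp (T t) := by
    intro s t
    ext u
    refine tendsto_nhds_unique (hT (s + t) u) ?_
    simp only [exp_add_smul]
    exact tendsto_clm_apply_of_bounded (fun n => hexp n s) (hT t u) (hT s (T t u))
  -- Continuity at `0`, first on the dense set, where the orbits are Lipschitz.
  have hcont0 : ∀ u, Tendsto (fun t => T t u) (𝓝 0) (𝓝 u) := by
    refine tendsto_self_of_dense (C := C * Real.exp (a * 1)) (by positivity) ?_ hD ?_
    · filter_upwards [Metric.ball_mem_nhds (0 : ℝ) one_pos] with t ht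
      refine (hTb t).trans ?_
      have : |t| ≤ 1 := by simpa using (Metric.mem_ball.1 ht).le
      gcongr
    · intro u hu
      obtain ⟨g, hg⟩ := hconv u hu
      have hb : ∀ t, ‖T t u - u‖ ≤ C * Real.exp (a * |t|) * ‖g‖ * |t| := fun t =>
        le_of_tendsto_of_tendsto ((hT t u).sub_const u).norm
          ((hg.norm.const_mul (C * Real.exp (a * |t|))).mul_const |t|)
          (Eventually.of_forall fun n => norm_exp_smul_apply_sub_le (B n) u (hexp' n t))
      rw [tendsto_iff_norm_sub_tendsto_zero]
      refine squeeze_zero (fun t => norm_nonneg _) hb ?_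
      have : Continuous fun t : ℝ => C * Real.exp (a * |t|) * ‖g‖ * |t| := by fun_prop
      simpa using this.tendsto 0
  have hcont : ∀ u, Continuous fun t => T t u := by
    intro u
    rw [continuous_iff_continuousAt]
    intro t
    have h1 : Tendsto (fun s => T t (T (s - t) u)) (𝓝 t) (𝓝 (T t u)) := by
      refine ((T t).continuous.tendsto u).comp ((hcont0 u).comp ?_)
      have : Continuous fun s : ℝ => s - t := by fun_prop
      simpa using this.tendsto t
    refine h1.congr fun s => ?_
    rw [← ContinuousLinearMap.comp_apply, ← hTadd]
    congr 2; ring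
  refine ⟨T, ⟨hT0, hTadd, hcont⟩, hT, fun u g hg => ?_⟩
  -- `T t u - u = ∫ s in 0..t, T s g`, as the limit of the same identity for `exp (t B n)`.
  have hint : ∀ t, T t u - u = ∫ s in (0 : ℝ)..t, T s g := by
    intro t
    have e1 : ∀ n, ∫ s in (0 : ℝ)..t, exp (s • B n) (B n u) = exp (t • B n) u - u := fun n => by
      have hc : Continuous fun s : ℝ => exp (s • B n) (B n u) :=
        continuous_iff_continuousAt.2 fun s =>
          (hasDerivAt_exp_smul_apply (B n) (B n u) s).continuousAt
      rw [intervalIntegral.integral_eq_sub_of_hasDerivAt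
        (fun s _ => hasDerivAt_exp_smul_apply (B n) u s) (hc.intervalIntegrable _ _)]
      simp
    have e2 : Tendsto (fun n => ∫ s in (0 : ℝ)..t, exp (s • B n) (B n u)) atTop
        (𝓝 (∫ s in (0 : ℝ)..t, T s g)) := by
      obtain ⟨b, hb⟩ := hg.norm.bddAbove_range
      refine intervalIntegral.tendsto_integral_filter_of_dominated_convergence
        (fun _ => C * Real.exp (a * |t|) * b) (Eventually.of_forall fun n => ?_)
        (Eventually.of_forall fun n => Eventually.of_forall fun s hs => ?_)
        intervalIntegrable_const (Eventually.of_forall fun s _ => ?_)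
      · exact (continuous_iff_continuousAt.2 fun s =>
          (hasDerivAt_exp_smul_apply (B n) (B n u) s).continuousAt).aestronglyMeasurable
      · have hs' : |s| ≤ |t| := by
          rcases mem_uIoc.1 hs with h | h
          · rw [abs_of_pos h.1, abs_of_pos (h.1.trans_le h.2)]; exact h.2
          · rw [abs_of_nonpos h.2, abs_of_neg (h.1.trans_le h.2)]; linarith [h.1]
        refine ((exp (s • B n)).le_of_opNorm_le (hexp' n t s hs') _).trans ?_
        have : ‖B n u‖ ≤ b := hb ⟨n, rfl⟩
        gcongr
      · exact tendsto_clm_apply_of_bounded (fun n => hexp n s) hg (hT s g)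
    simp only [e1] at e2
    exact tendsto_nhds_unique ((hT t u).sub_const u) e2
  have hd : HasDerivAt (fun t => ∫ s in (0 : ℝ)..t, T s g) (T 0 g) 0 :=
    intervalIntegral.integral_hasDerivAt_right ((hcont g).intervalIntegrable _ _)
      ((hcont g).stronglyMeasurableAtFilter _ _) (hcont g).continuousAt
  rw [hT0] at hd
  have := hd.add_const u
  refine this.congr_of_eventuallyEq (Eventually.of_forall fun t => ?_)
  simp [← hint]

end GroupLimit

/-! ### Resolvents and the Yosida approximation -/

section Resolvent

variable {H : Type*} [NormedAddCommGroup H] [NormedSpace ℂ H] {A : H →ₗ.[ℂ] H}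

theorem IsResolventAt.mem_graph {μ : ℂ} {R : H →L[ℂ] H} (h : IsResolventAt A μ R) (f : H) :
    (R f, μ • R f - f) ∈ A.graph := by
  obtain ⟨u, hu, hf⟩ := h.1 f
  rw [LinearPMap.mem_graph_iff]
  refine ⟨u, hu, ?_⟩
  change A u = μ • R f - f
  rw [← hu, ← hf, sub_sub_cancel]

theorem IsResolventAt.apply_of_mem_graph {μ : ℂ} {R : H →L[ℂ] H} (h : IsResolventAt A μ R)
    {u g : H} (hu : (u, g) ∈ A.graph) : R (μ • u - g) = u := by
  obtain ⟨v, hv, hg⟩ := (LinearPMap.mem_graph_iff _).1 hu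
  simp only at hv hg
  rw [← hv, ← hg]
  exact h.2 v

theorem IsResolventAt.smul_apply_sub_self {μ : ℂ} {R : H →L[ℂ] H} (h : IsResolventAt A μ R)
    {u g : H} (hu : (u, g) ∈ A.graph) : μ • R u - u = R g := by
  have h2 := h.apply_of_mem_graph hu
  rw [map_sub, map_smul] at h2
  exact sub_eq_of_eq_add (sub_eq_iff_eq_add'.1 h2)

/-- The resolvent commutes with `A`. -/
theorem IsResolventAt.map_mem_graph {μ : ℂ} {R : H →L[ℂ] H} (h : IsResolventAt A μ R)
    {u g : H} (hu : (u, g) ∈ A.graph) : (R u, R g) ∈ A.graph := by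
  rw [← h.smul_apply_sub_self hu]
  exact h.mem_graph u

theorem IsResolventAt.commute {μ ν : ℂ} {R S : H →L[ℂ] H} (hR : IsResolventAt A μ R)
    (hS : IsResolventAt A ν S) : Commute R S := by
  ext f
  have h := hR.apply_of_mem_graph (hS.map_mem_graph (hR.mem_graph f))
  rw [map_sub S, map_smul S, sub_sub_cancel] at h
  exact h

end Resolvent

section Yosida

open NormedSpace

variable {H : Type*} [NormedAddCommGroup H] [NormedSpace ℂ H] {A : H →ₗ.[ℂ] H}

/-- The two-sided Yosida approximation `A (1 - A / l)⁻¹ (1 + A / l)⁻¹` of `A`, expressed through the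
resolvents `Rp` and `Rm` of `A` at `l` and `-l`. In contrast to the usual approximation
`A (1 - A / l)⁻¹`, it inherits a two-sided bound for the quadratic form of `A`. -/
def yosida (l : ℝ) (Rp Rm : H →L[ℂ] H) : H →L[ℂ] H :=
  (l : ℂ) • (((l : ℂ) • Rp - 1) * ((-l : ℂ) • Rm))

theorem yosida_apply (l : ℝ) (Rp Rm : H →L[ℂ] H) (u : H) : yosida l Rp Rm u =
    (l : ℂ) • ((l : ℂ) • Rp ((-l : ℂ) • Rm u) - (-l : ℂ) • Rm u) := rfl

/-- On the domain of `A`, the Yosida approximation is `(1 - A / l)⁻¹ (1 + A / l)⁻¹ A`, which tends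
to `A` as `l → ∞`. -/
theorem yosida_apply_of_mem_graph {l : ℝ} {Rp Rm : H →L[ℂ] H} (hp : IsResolventAt A (l : ℂ) Rp)
    (hm : IsResolventAt A ((-l : ℝ) : ℂ) Rm) {u g : H} (hu : (u, g) ∈ A.graph) :
    yosida l Rp Rm u = ((l : ℂ) • Rp) (((-l : ℂ) • Rm) g) := by
  have h2 := hp.smul_apply_sub_self (hm.map_mem_graph hu)
  rw [yosida_apply]
  change _ = (l : ℂ) • Rp ((-l : ℂ) • Rm g)
  rw [map_smul, map_smul, ← h2, smul_comm (l : ℂ) (-l : ℂ) (Rp (Rm u)), ← smul_sub]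

theorem norm_smul_resolvent_le {ρ K l x r : ℝ} (hK : 0 ≤ K) (hρ : 0 ≤ ρ) (hx : |x| = l)
    (hl : 1 + 2 * ρ ≤ l) (hr : r ≤ K / (l - ρ)) : |x| * r ≤ 2 * K := by
  have h0 : 0 < l - ρ := by linarith
  calc |x| * r ≤ l * (K / (l - ρ)) := by
        rw [hx]; exact mul_le_mul_of_nonneg_left hr (by linarith)
    _ ≤ 2 * K := by
        rw [← mul_div_assoc, div_le_iff₀ h0]
        nlinarith

variable [CompleteSpace H]

/-- A two-sided Hille–Yosida theorem, with the growth bound stated for the Yosida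
approximations. The generator is characterized by the derivative of the orbits at `0` along an
arbitrary filter, so that right and left derivatives are covered. -/
theorem exists_group_of_resolvent_bound {ρ K : ℝ} (hρ : 0 ≤ ρ) (hK : 0 ≤ K)
    {R : ℝ → H →L[ℂ] H} (hR : ∀ l : ℝ, ρ < |l| → IsResolventAt A (l : ℂ) (R l))
    (hRb : ∀ l : ℝ, ρ < |l| → ‖R l‖ ≤ K / (|l| - ρ)) (hD : Dense (A.domain : Set H))
    {C a : ℝ} (ha : 0 ≤ a) (hexp : ∀ l : ℝ, 1 + 2 * ρ ≤ l → ∀ t : ℝ,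
      ‖exp (t • yosida l (R l) (R (-l)))‖ ≤ C * Real.exp (a * |t|)) :
    ∃ T : ℝ → H →L[ℂ] H, IsC0Group T ∧ ∀ l : Filter ℝ, l.NeBot → l ≤ 𝓝[≠] 0 →
      ∀ u f : H, (u, f) ∈ A.graph ↔
        Tendsto (fun t : ℝ => (t : ℂ)⁻¹ • (T t u - u)) l (𝓝 f) := by
  set lam : ℕ → ℝ := fun n => n + (1 + 2 * ρ) with hlam
  have hlam1 : ∀ n, 1 + 2 * ρ ≤ lam n := fun n => by
    have : (0 : ℝ) ≤ n := n.cast_nonneg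
    simp only [hlam]; linarith
  have hlam0 : ∀ n, 0 < lam n := fun n => by linarith [hlam1 n]
  have habs : ∀ n, |lam n| = lam n := fun n => abs_of_pos (hlam0 n)
  have habs' : ∀ n, |-lam n| = lam n := fun n => by rw [abs_neg, habs]
  have hgt : ∀ n, ρ < |lam n| := fun n => by rw [habs]; linarith [hlam1 n]
  have hgt' : ∀ n, ρ < |-lam n| := fun n => by rw [habs']; linarith [hlam1 n]
  set B : ℕ → H →L[ℂ] H := fun n => yosida (lam n) (R (lam n)) (R (-lam n)) with hB
  -- `l (l - A)⁻¹` converges strongly to `1` as `l → ±∞`.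
  have hJ : ∀ (x : ℕ → ℝ), (∀ n, |x n| = lam n) →
      (∀ n, ‖(x n : ℂ) • R (x n)‖ ≤ 2 * K) ∧
      ∀ u, Tendsto (fun n => ((x n : ℂ) • R (x n)) u) atTop (𝓝 u) := by
    intro x hx
    have hgx : ∀ n, ρ < |x n| := fun n => by rw [hx]; linarith [hlam1 n]
    have hb : ∀ n, ‖(x n : ℂ) • R (x n)‖ ≤ 2 * K := fun n => by
      rw [norm_smul, Complex.norm_real]
      refine norm_smul_resolvent_le hK hρ (hx n) (hlam1 n) ?_
      have := hRb _ (hgx n)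
      rwa [hx] at this
    refine ⟨hb, tendsto_self_of_dense (C := 2 * K) (by positivity) (Eventually.of_forall hb) hD ?_⟩
    intro u hu
    have hg : (u, A ⟨u, hu⟩) ∈ A.graph := A.mem_graph ⟨u, hu⟩
    rw [tendsto_iff_norm_sub_tendsto_zero]
    have hle : ∀ n, ‖((x n : ℂ) • R (x n)) u - u‖ ≤ K / (lam n - ρ) * ‖A ⟨u, hu⟩‖ := fun n => by
      have h2 := (hR _ (hgx n)).smul_apply_sub_self hg
      have h3 := hRb _ (hgx n)
      rw [hx] at h3
      rw [smul_apply, h2]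
      exact (R (x n)).le_of_opNorm_le h3 _
    refine squeeze_zero (fun n => norm_nonneg _) hle ?_
    have ht : Tendsto (fun n => lam n - ρ) atTop atTop := by
      have : (fun n => lam n - ρ) = fun n : ℕ => (n : ℝ) + (1 + ρ) := by
        funext n; simp only [hlam]; ring
      rw [this]
      exact tendsto_atTop_add_const_right _ _ tendsto_natCast_atTop_atTop
    simpa using (ht.const_div_atTop K).mul_const ‖A ⟨u, hu⟩‖
  obtain ⟨hJpb, hJp⟩ := hJ lam habs
  obtain ⟨hJmb, hJm⟩ := hJ (fun n => -lam n) habs'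
  have hBlim : ∀ u g, (u, g) ∈ A.graph → Tendsto (fun n => B n u) atTop (𝓝 g) := by
    intro u g hu
    have h1 := tendsto_clm_apply_of_bounded hJpb (hJm g) (hJp g)
    refine h1.congr fun n => ?_
    have := yosida_apply_of_mem_graph (hR _ (hgt n)) (hR _ (hgt' n)) hu
    simp only [hB, this]
    push_cast
    rfl
  have hRB : ∀ n x, ρ < |x| → Commute (B n) (R x) := fun n x hx => by
    refine Commute.smul_left (Commute.mul_left (Commute.sub_left (Commute.smul_left ?_ _)
      (Commute.one_left _)) (Commute.smul_left ?_ _)) _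
    · exact (hR _ (hgt n)).commute (hR _ hx)
    · exact (hR _ (hgt' n)).commute (hR _ hx)
  have hcomm : ∀ n m, Commute (B n) (B m) := fun n m => by
    refine Commute.smul_right (Commute.mul_right (Commute.sub_right (Commute.smul_right ?_ _)
      (Commute.one_right _)) (Commute.smul_right ?_ _)) _
    · exact hRB n _ (hgt m)
    · exact hRB n _ (hgt' m)
  obtain ⟨T, hT, hTlim, hTd⟩ := exists_group_of_tendsto hcomm ha (fun n t => hexp _ (hlam1 n) t) hD
    (fun u hu => ⟨A ⟨u, hu⟩, hBlim u _ (A.mem_graph ⟨u, hu⟩)⟩)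
  have hslope : ∀ l : Filter ℝ, l ≤ 𝓝[≠] 0 → ∀ u f : H, (u, f) ∈ A.graph →
      Tendsto (fun t : ℝ => (t : ℂ)⁻¹ • (T t u - u)) l (𝓝 f) := by
    intro l hl u f hu
    have h := (hasDerivAt_iff_tendsto_slope.1 (hTd u f (hBlim u f hu))).mono_left hl
    refine h.congr fun t => ?_
    rw [slope_def_module, hT.map_zero, sub_zero, ← Complex.ofReal_inv, Complex.coe_smul]
    rfl
  refine ⟨T, hT, fun l hl0 hl u f => ⟨hslope l hl u f, fun hf => ?_⟩⟩
  -- The group commutes with the resolvent `R x`, so that `A (R x u) = R x f`.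
  set x := lam 0
  have hS := hR x (hgt 0)
  have hTS : ∀ t v, T t (R x v) = R x (T t v) := fun t v => by
    refine tendsto_nhds_unique (hTlim t (R x v)) ?_
    refine (((R x).continuous.tendsto _).comp (hTlim t v)).congr fun n => ?_
    have : Commute (R x) (exp (t • B n)) := (((hRB n x (hgt 0)).symm).smul_right t).exp_right
    exact congrArg (fun Z : H →L[ℂ] H => Z v) this
  have h1 := hslope l hl _ _ (hS.mem_graph u)
  have h2 : Tendsto (fun t : ℝ => (t : ℂ)⁻¹ • (T t (R x u) - R x u)) l (𝓝 (R x f)) := by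
    refine (((R x).continuous.tendsto f).comp hf).congr fun t => ?_
    simp only [Function.comp, map_smul, map_sub, hTS]
  have h3 := tendsto_nhds_unique h1 h2
  have h4 := hS.mem_graph ((x : ℂ) • u - f)
  have h5 : R x ((x : ℂ) • u - f) = u := by
    rw [map_sub, map_smul, ← h3, sub_sub_cancel]
  rwa [h5, sub_sub_cancel] at h4

end Yosida

/-! ### Group generation from energy estimates in a Hilbert space -/

section Energy

open NormedSpace

variable {H : Type*} [NormedAddCommGroup H] [InnerProductSpace ℂ H]
  {A : H →ₗ.[ℂ] H} {P : H →L[ℂ] H} {m c : ℝ}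

/-- If the quadratic form of `B` with respect to the inner product `(u, v) ↦ ⟪P v, u⟫` is bounded
by `b ‖u‖²`, then the energy `⟪P u, u⟫` grows at most at the exponential rate `2 b / m`. -/
theorem norm_exp_smul_le_of_energy [CompleteSpace H]
    (hPs : ∀ x y, inner ℂ (P x) y = inner ℂ x (P y)) (hm : 0 < m)
    (hPm : ∀ x, m * ‖x‖ ^ 2 ≤ (inner ℂ (P x) x).re) {B : H →L[ℂ] H} {b : ℝ} (hb : 0 ≤ b)
    (hB : ∀ u, |(inner ℂ (P (B u)) u).re| ≤ b * ‖u‖ ^ 2) (t : ℝ) :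
    ‖exp (t • B)‖ ≤ √(‖P‖ / m) * Real.exp (b / m * |t|) := by
  have main : ∀ (B : H →L[ℂ] H), (∀ u, |(inner ℂ (P (B u)) u).re| ≤ b * ‖u‖ ^ 2) →
      ∀ t : ℝ, 0 ≤ t → ‖exp (t • B)‖ ≤ √(‖P‖ / m) * Real.exp (b / m * t) := by
    intro B hB t ht
    refine ContinuousLinearMap.opNorm_le_bound _ (by positivity) fun u => ?_
    set E : H → ℝ := fun x => (inner ℂ (P x) x).re with hE
    have hd : ∀ s : ℝ, HasDerivAt (fun s : ℝ => E (exp (s • B) u))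
        (2 * (inner ℂ (P (B (exp (s • B) u))) (exp (s • B) u)).re) s := by
      intro s
      have h1 : HasDerivAt (fun s : ℝ => exp (s • B) u) (B (exp (s • B) u)) s := by
        have hc : Commute B (exp (s • B)) := ((Commute.refl B).smul_right s).exp_right
        have := hasDerivAt_exp_smul_apply B u s
        rwa [show exp (s • B) (B u) = B (exp (s • B) u) from
          congrArg (fun Z : H →L[ℂ] H => Z u) hc.symm] at this
      have h2 : HasDerivAt (fun s : ℝ => P (exp (s • B) u)) (P (B (exp (s • B) u))) s :=
        (P.restrictScalars ℝ).hasFDerivAt.comp_hasDerivAt s h1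
      have h3 := Complex.reCLM.hasFDerivAt.comp_hasDerivAt s (h2.inner ℂ h1)
      refine h3.congr_deriv ?_
      rw [Complex.reCLM_apply, Complex.add_re, hPs, ← inner_conj_symm, Complex.conj_re, two_mul]
    have hanti : Antitone fun s : ℝ => Real.exp (-(2 * (b / m)) * s) * E (exp (s • B) u) := by
      have hd2 : ∀ s : ℝ, HasDerivAt
          (fun s : ℝ => Real.exp (-(2 * (b / m)) * s) * E (exp (s • B) u))
          (Real.exp (-(2 * (b / m)) * s) * (-(2 * (b / m)) * 1) * E (exp (s • B) u) +
            Real.exp (-(2 * (b / m)) * s) *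
              (2 * (inner ℂ (P (B (exp (s • B) u))) (exp (s • B) u)).re)) s := fun s =>
        (((hasDerivAt_id s).const_mul (-(2 * (b / m)))).exp).mul (hd s)
      refine antitone_of_deriv_nonpos (fun s => (hd2 s).differentiableAt) fun s => ?_
      rw [(hd2 s).deriv]
      set x := exp (s • B) u
      have h1 := (abs_le.1 (hB x)).2
      have h2 : b * ‖x‖ ^ 2 ≤ b / m * E x := by
        rw [div_mul_eq_mul_div, le_div_iff₀ hm]
        nlinarith [mul_le_mul_of_nonneg_left (hPm x) hb]
      have h3 : Real.exp (-(2 * (b / m)) * s) * (-(2 * (b / m)) * 1) * E x +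
            Real.exp (-(2 * (b / m)) * s) * (2 * (inner ℂ (P (B x)) x).re) =
          Real.exp (-(2 * (b / m)) * s) * (2 * ((inner ℂ (P (B x)) x).re - b / m * E x)) := by
        ring
      rw [h3]
      exact mul_nonpos_of_nonneg_of_nonpos (Real.exp_pos _).le (by linarith)
    have h0 := hanti ht
    simp only [mul_zero, Real.exp_zero, one_mul, zero_smul, exp_zero] at h0
    have h1 : E (exp (t • B) u) ≤ Real.exp (2 * (b / m) * t) * E u := by
      have : Real.exp (2 * (b / m) * t) * (Real.exp (-(2 * (b / m)) * t) * E (exp (t • B) u))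
          = E (exp (t • B) u) := by
        rw [← mul_assoc, ← Real.exp_add]
        simp
      rw [← this]
      exact mul_le_mul_of_nonneg_left h0 (Real.exp_pos _).le
    have h2 : E u ≤ ‖P‖ * ‖u‖ ^ 2 := by
      calc E u ≤ ‖inner ℂ (P u) u‖ := Complex.re_le_norm _
        _ ≤ ‖P u‖ * ‖u‖ := norm_inner_le_norm _ _
        _ ≤ ‖P‖ * ‖u‖ * ‖u‖ := by gcongr; exact P.le_opNorm u
        _ = ‖P‖ * ‖u‖ ^ 2 := by ring
    refine (abs_le_of_sq_le_sq' ?_ (by positivity)).2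
    have h3 : m * ‖exp (t • B) u‖ ^ 2 ≤ Real.exp (2 * (b / m) * t) * (‖P‖ * ‖u‖ ^ 2) :=
      (hPm _).trans (h1.trans (mul_le_mul_of_nonneg_left h2 (Real.exp_pos _).le))
    rw [mul_pow, mul_pow, Real.sq_sqrt (by positivity), ← Real.exp_nat_mul]
    rw [div_mul_eq_mul_div, div_mul_eq_mul_div, le_div_iff₀ hm]
    have e : ((2 : ℕ) : ℝ) * (b / m * t) = 2 * (b / m) * t := by push_cast; ring
    rw [e]
    linarith
  rcases le_total 0 t with h | h
  · rw [abs_of_nonneg h]; exact main B hB t h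
  · rw [abs_of_nonpos h]
    have := main (-B) (fun u => by simpa using hB u) (-t) (by linarith)
    simpa using this

theorem norm_resolvent_le_of_energy (hm : 0 < m)
    (hPm : ∀ x, m * ‖x‖ ^ 2 ≤ (inner ℂ (P x) x).re)
    (hA : ∀ u g, (u, g) ∈ A.graph → |(inner ℂ (P g) u).re| ≤ c * ‖u‖ ^ 2) {l : ℝ}
    (hl : c / m < |l|) {R : H →L[ℂ] H} (hR : IsResolventAt A (l : ℂ) R) :
    ‖R‖ ≤ ‖P‖ / m / (|l| - c / m) := by
  have h0 : 0 < |l| - c / m := by linarith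
  refine ContinuousLinearMap.opNorm_le_bound _ (by positivity) fun f => ?_
  have h1 := abs_le.1 (hA _ _ (hR.mem_graph f))
  set u := R f
  have h2 : (inner ℂ (P ((l : ℂ) • u - f)) u).re =
      l * (inner ℂ (P u) u).re - (inner ℂ (P f) u).re := by
    rw [map_sub, map_smul, inner_sub_left, inner_smul_left]
    simp
  rw [h2] at h1
  have h3 : |(inner ℂ (P f) u).re| ≤ ‖P‖ * ‖f‖ * ‖u‖ :=
    (Complex.abs_re_le_norm _).trans ((norm_inner_le_norm _ _).trans
      (mul_le_mul_of_nonneg_right (P.le_opNorm f) (norm_nonneg _)))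
  have h4 := abs_le.1 h3
  have h5 := hPm u
  have h6 : |l| * (m * ‖u‖ ^ 2) ≤ c * ‖u‖ ^ 2 + ‖P‖ * ‖f‖ * ‖u‖ := by
    have : |l| * (m * ‖u‖ ^ 2) ≤ |l| * (inner ℂ (P u) u).re :=
      mul_le_mul_of_nonneg_left h5 (abs_nonneg _)
    rcases abs_cases l with h | h <;> rw [h.1] at this ⊢ <;> nlinarith
  have h7 : (|l| - c / m) * m = |l| * m - c := by field_simp
  rw [div_mul_eq_mul_div, div_mul_eq_mul_div, div_div, le_div_iff₀ (by positivity)]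
  rcases (norm_nonneg u).eq_or_lt with h | h
  · rw [← h]; simp; positivity
  · have : (|l| * m - c) * ‖u‖ * ‖u‖ ≤ ‖P‖ * ‖f‖ * ‖u‖ := by nlinarith
    have := le_of_mul_le_mul_right this h
    rw [mul_comm m, h7]
    linarith

/-- The Yosida approximation inherits the energy estimate. This rests on the second resolvent in its
definition: with `v = (1 - A / l)⁻¹ (1 + A / l)⁻¹ u` one has `u = v - A² v / l²`, and the form of
the approximation at `u` is the difference of the forms of `A` at `v` and at `A v / l`. -/
theorem energy_yosida_le (hPs : ∀ x y, inner ℂ (P x) y = inner ℂ x (P y))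
    (hc : 0 ≤ c)
    (hA : ∀ u g, (u, g) ∈ A.graph → |(inner ℂ (P g) u).re| ≤ c * ‖u‖ ^ 2) {l : ℝ}
    {Rp Rm : H →L[ℂ] H} (hp : IsResolventAt A (l : ℂ) Rp)
    (hm : IsResolventAt A ((-l : ℝ) : ℂ) Rm) {K : ℝ}
    (hKp : |l| * ‖Rp‖ ≤ K) (hKm : |l| * ‖Rm‖ ≤ K) (u : H) :
    |(inner ℂ (P (yosida l Rp Rm u)) u).re| ≤ c * ((K * K) ^ 2 + (K * K + K) ^ 2) * ‖u‖ ^ 2 := by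
  have hK : 0 ≤ K := le_trans (by positivity) hKp
  have hn : ∀ {R : H →L[ℂ] H} (x : ℂ), |l| * ‖R‖ ≤ K → ‖x‖ = |l| → ∀ v, ‖x • R v‖ ≤ K * ‖v‖ := by
    intro R x hR hx v
    rw [norm_smul, hx]
    calc |l| * ‖R v‖ ≤ |l| * (‖R‖ * ‖v‖) := by gcongr; exact R.le_opNorm v
      _ = |l| * ‖R‖ * ‖v‖ := by ring
      _ ≤ K * ‖v‖ := by gcongr
  set z := (-l : ℂ) • Rm u with hz
  set v := (l : ℂ) • Rp z with hv
  set w := v - z with hw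
  have hzn : ‖z‖ ≤ K * ‖u‖ := hn (-l : ℂ) hKm (by simp) u
  have hvn : ‖v‖ ≤ K * K * ‖u‖ := by
    refine (hn (l : ℂ) hKp (by simp) z).trans ?_
    rw [mul_assoc]; gcongr
  have hwn : ‖w‖ ≤ (K * K + K) * ‖u‖ := (norm_sub_le _ _).trans (by linarith)
  have hvA : (v, (l : ℂ) • w) ∈ A.graph := by
    have := A.graph.smul_mem (l : ℂ) (hp.mem_graph z)
    exact this
  have hzA : (z, (l : ℂ) • (u - z)) ∈ A.graph := by
    have := A.graph.smul_mem (-l : ℂ) (hm.mem_graph u)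
    have e : (-l : ℂ) • (((-l : ℝ) : ℂ) • Rm u - u) = (l : ℂ) • (u - z) := by
      rw [hz]; push_cast; simp only [smul_sub, smul_neg, neg_smul, neg_neg]; abel
    rwa [Prod.smul_mk, e] at this
  have hwA : (w, (l : ℂ) • (v - u)) ∈ A.graph := by
    have := A.graph.sub_mem hvA hzA
    rw [Prod.mk_sub_mk, ← smul_sub] at this
    convert this using 3
    rw [hw]; abel
  -- As `A v = l w` and `A w = l (v - u)`, the form is the real part of
  -- `⟪P (A v), v⟫ - ⟪P (A w), w⟫`.
  have e : (inner ℂ (P (yosida l Rp Rm u)) u).re =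
      (inner ℂ (P ((l : ℂ) • w)) v).re - (inner ℂ (P ((l : ℂ) • (v - u))) w).re := by
    have h1 : yosida l Rp Rm u = (l : ℂ) • w := by
      rw [yosida_apply]
    have h2 : (inner ℂ (P ((l : ℂ) • (v - u))) w).re = (inner ℂ (P ((l : ℂ) • w)) (v - u)).re := by
      rw [map_smul, inner_smul_left, hPs, ← inner_conj_symm, map_smul, inner_smul_left]
      simp only [Complex.conj_ofReal, Complex.re_ofReal_mul, Complex.conj_re]
    rw [h1, h2, inner_sub_right, Complex.sub_re]
    ring
  rw [e]
  have a1 := hA _ _ hvA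
  have a2 := hA _ _ hwA
  have b1 : ‖v‖ ^ 2 ≤ (K * K * ‖u‖) ^ 2 := pow_le_pow_left₀ (norm_nonneg _) hvn 2
  have b2 : ‖w‖ ^ 2 ≤ ((K * K + K) * ‖u‖) ^ 2 := pow_le_pow_left₀ (norm_nonneg _) hwn 2
  refine (abs_sub _ _).trans ?_
  calc _ ≤ c * (K * K * ‖u‖) ^ 2 + c * ((K * K + K) * ‖u‖) ^ 2 :=
        add_le_add (a1.trans (mul_le_mul_of_nonneg_left b1 hc))
          (a2.trans (mul_le_mul_of_nonneg_left b2 hc))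
    _ = _ := by ring

/-- In a Hilbert space the domain of an operator that satisfies an energy estimate and has a
resolvent is automatically dense. -/
theorem dense_domain_of_energy [CompleteSpace H] (hm : 0 < m)
    (hPm : ∀ x, m * ‖x‖ ^ 2 ≤ (inner ℂ (P x) x).re)
    (hA : ∀ u g, (u, g) ∈ A.graph → |(inner ℂ (P g) u).re| ≤ c * ‖u‖ ^ 2) {l : ℝ}
    (hl : c / m < l) (hl0 : 0 ≤ l) {R : H →L[ℂ] H} (hR : IsResolventAt A (l : ℂ) R) :
    Dense (A.domain : Set H) := by
  rw [Submodule.dense_iff_topologicalClosure_eq_top, Submodule.topologicalClosure_eq_top_iff,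
    Submodule.eq_bot_iff]
  intro y hy
  have hu : IsUnit P := by
    refine ContinuousLinearMap.isUnit_of_forall_le_norm_inner_map P (c := ⟨m, hm.le⟩) hm fun x => ?_
    rw [mul_comm]
    exact (hPm x).trans (Complex.re_le_norm _)
  -- `y = P f` for some `f`, and the energy estimate for `R f` yields `R f = 0`.
  obtain ⟨f, rfl⟩ : ∃ f, P f = y := by
    obtain ⟨V, hV⟩ := hu.exists_right_inv
    exact ⟨V y, congrArg (fun Z : H →L[ℂ] H => Z y) hV⟩
  have hg := hR.mem_graph f
  have h1 := (abs_le.1 (hA _ _ hg)).2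
  have h2 := hPm (R f)
  have h3 : inner ℂ (P f) (R f) = 0 :=
    (Submodule.mem_orthogonal' _ _).1 hy _ (LinearPMap.mem_domain_of_mem_graph hg)
  rw [map_sub, map_smul, inner_sub_left, inner_smul_left, h3, sub_zero, Complex.conj_ofReal,
    Complex.re_ofReal_mul] at h1
  have h4 : R f = 0 := by
    by_contra hne
    have h5 : 0 < ‖R f‖ ^ 2 := by positivity
    have h6 : c < l * m := (div_lt_iff₀ hm).1 hl
    nlinarith [mul_le_mul_of_nonneg_left h2 hl0]
  rw [h4, smul_zero, zero_sub] at hg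
  have h5 := A.graph_fst_eq_zero_snd hg rfl
  rw [neg_eq_zero.1 h5, map_zero]

/-- An operator with a two-sided energy estimate whose resolvent exists for all large `|l|`, `l`
real, generates a group. -/
theorem exists_group_of_energy [CompleteSpace H]
    (hPs : ∀ x y, inner ℂ (P x) y = inner ℂ x (P y)) (hm : 0 < m)
    (hPm : ∀ x, m * ‖x‖ ^ 2 ≤ (inner ℂ (P x) x).re) (hc : 0 ≤ c)
    (hA : ∀ u g, (u, g) ∈ A.graph → |(inner ℂ (P g) u).re| ≤ c * ‖u‖ ^ 2)
    (hR : ∀ l : ℝ, c / m < |l| → (l : ℂ) ∈ resolventSet A) :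
    ∃ T : ℝ → H →L[ℂ] H, IsC0Group T ∧ ∀ l : Filter ℝ, l.NeBot → l ≤ 𝓝[≠] 0 →
      ∀ u f : H, (u, f) ∈ A.graph ↔
        Tendsto (fun t : ℝ => (t : ℂ)⁻¹ • (T t u - u)) l (𝓝 f) := by
  have hρ : 0 ≤ c / m := by positivity
  have hK : 0 ≤ ‖P‖ / m := by positivity
  choose! R hR using hR
  have hRb : ∀ l : ℝ, c / m < |l| → ‖R l‖ ≤ ‖P‖ / m / (|l| - c / m) := fun l hl =>
    norm_resolvent_le_of_energy hm hPm hA hl (hR l hl)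
  have hD : Dense (A.domain : Set H) := by
    have hl : c / m < |c / m + 1| := by rw [abs_of_pos (by positivity)]; linarith
    exact dense_domain_of_energy hm hPm hA (l := c / m + 1) (by linarith) (by positivity)
      (hR _ hl)
  refine exists_group_of_resolvent_bound hρ hK hR hRb hD
    (a := c * ((2 * (‖P‖ / m) * (2 * (‖P‖ / m))) ^ 2 +
      (2 * (‖P‖ / m) * (2 * (‖P‖ / m)) + 2 * (‖P‖ / m)) ^ 2) / m) (by positivity)
    (C := √(‖P‖ / m)) fun l hl t => ?_
  have hl0 : 0 < l := by linarith
  have habs : |l| = l := abs_of_pos hl0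
  have h1 : c / m < |l| := by rw [habs]; linarith
  have h2 : c / m < |-l| := by rwa [abs_neg]
  refine norm_exp_smul_le_of_energy hPs hm hPm (by positivity) (fun u => ?_) t
  refine energy_yosida_le hPs hc hA (hR l h1) (hR (-l) h2) ?_ ?_ u
  · refine norm_smul_resolvent_le hK hρ habs hl ?_
    have := hRb l h1
    rwa [habs] at this
  · refine norm_smul_resolvent_le hK hρ habs hl ?_
    have := hRb (-l) h2
    rwa [abs_neg, habs] at this

end Energy

/-! ### Generators of groups and of semigroups -/

section Generation

variable {H : Type*} [NormedAddCommGroup H] [NormedSpace ℂ H] {A : H →ₗ.[ℂ] H}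

theorem mem_graph_neg_iff {u f : H} : (u, f) ∈ (-A).graph ↔ (u, -f) ∈ A.graph := by
  simp only [LinearPMap.mem_graph_iff]
  constructor
  · rintro ⟨y, h1, h2⟩
    exact ⟨y, h1, by rw [← h2]; simp⟩
  · rintro ⟨y, h1, h2⟩
    exact ⟨y, h1, by rw [LinearPMap.neg_apply]; simp [h2]⟩

/-- The generator of a group and its negative generate the semigroups of positive and of negative
times. -/
theorem generates_of_exists_group {T : ℝ → H →L[ℂ] H} (hT : IsC0Group T)
    (h : ∀ l : Filter ℝ, l.NeBot → l ≤ 𝓝[≠] 0 → ∀ u f : H, (u, f) ∈ A.graph ↔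
        Tendsto (fun t : ℝ => (t : ℂ)⁻¹ • (T t u - u)) l (𝓝 f)) :
    GeneratesC0Semigroup A ∧ GeneratesC0Semigroup (-A) ∧ GeneratesC0Group A := by
  refine ⟨⟨fun t => T t, ⟨hT.map_zero, fun s t => hT.map_add s t, fun u =>
    (hT.continuous_orbit u).comp NNReal.continuous_coe⟩, fun u f => ?_⟩,
    ⟨fun t => T (-t), ⟨?_, fun s t => ?_, fun u =>
    (hT.continuous_orbit u).comp NNReal.continuous_coe.neg⟩, fun u f => ?_⟩,
    ⟨T, hT, h _ inferInstance le_rfl⟩⟩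
  · have hl : Tendsto (fun t : ℝ≥0 => (t : ℝ)) (𝓝[>] 0) (𝓝[≠] 0) := by
      refine tendsto_nhdsWithin_iff.2 ⟨?_, ?_⟩
      · exact (NNReal.continuous_coe.tendsto 0).mono_left nhdsWithin_le_nhds
      · filter_upwards [self_mem_nhdsWithin] with t ht
        have : (0 : ℝ≥0) < t := ht
        simpa using this.ne'
    exact h (map (fun t : ℝ≥0 => (t : ℝ)) (𝓝[>] 0)) inferInstance hl u f
  · simp [hT.map_zero]
  · rw [← hT.map_add, NNReal.coe_add, neg_add]
  · have hl : Tendsto (fun t : ℝ≥0 => -(t : ℝ)) (𝓝[>] 0) (𝓝[≠] 0) := by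
      refine tendsto_nhdsWithin_iff.2 ⟨?_, ?_⟩
      · have : Continuous fun t : ℝ≥0 => -(t : ℝ) := NNReal.continuous_coe.neg
        simpa using (this.tendsto 0).mono_left (nhdsWithin_le_nhds (s := Ioi (0 : ℝ≥0)))
      · filter_upwards [self_mem_nhdsWithin] with t ht
        have : (0 : ℝ≥0) < t := ht
        simpa using this.ne'
    rw [mem_graph_neg_iff, h (map (fun t : ℝ≥0 => -(t : ℝ)) (𝓝[>] 0)) inferInstance hl u (-f),
      tendsto_map'_iff, ← tendsto_neg_iff, neg_neg]
    refine tendsto_congr fun t => ?_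
    simp [inv_neg, neg_smul]

end Generation

/-! ### Compact resolvents -/

section CompactResolvent

variable {H : Type*} [NormedAddCommGroup H] [NormedSpace ℂ H] {A : H →ₗ.[ℂ] H}

theorem notMem_resolventSet_of_mem_pointSpectrum {μ : ℂ} (h : μ ∈ pointSpectrum A) :
    μ ∉ resolventSet A := by
  rintro ⟨R, hR⟩
  obtain ⟨u, hu, hA⟩ := h
  have := hR.2 u
  rw [hA, sub_self, map_zero] at this
  exact hu this.symm

variable {K C : H →L[ℂ] H}

/-- If the compact operator `K` is a left inverse of `A - C`, with `C` bounded, then all resolvents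
of `A` are compact. -/
theorem isCompactOperator_of_isResolventAt (hK : IsCompactOperator K)
    (hKl : ∀ u g, (u, g) ∈ A.graph → K (g - C u) = u) {μ : ℂ} {R : H →L[ℂ] H}
    (hR : IsResolventAt A μ R) : IsCompactOperator R := by
  have e : R = K.comp (μ • R - 1 - C.comp R) := by
    ext f
    exact (hKl _ _ (hR.mem_graph f)).symm
  rw [e]
  exact hK.comp_clm _

/-- If the compact operator `K` is a right inverse of `A - C`, with `C` bounded, then
`(μ - A) K = -(1 - (μ - C) K)`, and by the Fredholm alternative `μ` is an eigenvalue or belongs to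
the resolvent set. -/
theorem mem_resolventSet_of_notMem_pointSpectrum [CompleteSpace H] (hK : IsCompactOperator K)
    (hKr : ∀ f, (K f, f + C (K f)) ∈ A.graph) {μ : ℂ} (hμ : μ ∉ pointSpectrum A) :
    μ ∈ resolventSet A := by
  have hinj : ∀ u, (u, μ • u) ∈ A.graph → u = 0 := by
    intro u hu
    by_contra hne
    obtain ⟨v, hv, hA⟩ := (LinearPMap.mem_graph_iff _).1 hu
    simp only at hv hA
    exact hμ ⟨v, by rwa [hv], by rw [hA, hv]⟩
  set S : H →L[ℂ] H := (μ • 1 - C).comp K with hS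
  have hSc : IsCompactOperator S := by
    rw [hS, ContinuousLinearMap.coe_comp]
    exact hK.clm_comp (μ • 1 - C)
  have hSf : ∀ f, S f = μ • K f - C (K f) := fun f => rfl
  have h1 : (1 : ℂ) ∈ _root_.resolventSet ℂ S := by
    refine (hSc.hasEigenvalue_or_mem_resolventSet one_ne_zero).resolve_left fun h => ?_
    obtain ⟨f, hf⟩ := h.exists_hasEigenvector
    have hfS : S f = f := by simpa using hf.apply_eq_smul
    have hg := hKr f
    have e : f + C (K f) = μ • K f := by
      nth_rewrite 1 [← hfS]
      rw [hSf, sub_add_cancel]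
    rw [e] at hg
    have h0 := hinj _ hg
    refine hf.2 ?_
    rw [← hfS, hSf, h0, smul_zero, map_zero, sub_zero]
  obtain ⟨W, hW⟩ : IsUnit (1 - S) := by
    have := spectrum.mem_resolventSet_iff.1 h1
    simpa using this
  have hr : ∀ f, (1 - S) ((↑W⁻¹ : H →L[ℂ] H) f) = f := fun f => by
    have : (1 - S) * (↑W⁻¹ : H →L[ℂ] H) = 1 := by rw [← hW]; exact W.mul_inv
    exact congrArg (fun Z : H →L[ℂ] H => Z f) this
  set R : H →L[ℂ] H := -(K.comp (↑W⁻¹ : H →L[ℂ] H)) with hRdef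
  have hRg : ∀ f, (R f, μ • R f - f) ∈ A.graph := fun f => by
    set g := (↑W⁻¹ : H →L[ℂ] H) f with hg
    have h2 := A.graph.neg_mem (hKr g)
    have h3 : f = g - (μ • K g - C (K g)) := by
      rw [← hSf]; exact (hr f).symm
    have e : (R f, μ • R f - f) = -(K g, g + C (K g)) := by
      rw [Prod.neg_mk]
      congr 1
      change μ • (-(K g)) - f = _
      rw [h3, smul_neg]
      abel
    rwa [e]
  refine ⟨R, fun f => ?_, fun u => ?_⟩
  · obtain ⟨u, hu, hA⟩ := (LinearPMap.mem_graph_iff _).1 (hRg f)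
    simp only at hu hA
    exact ⟨u, hu, by rw [hA, hu, sub_sub_cancel]⟩
  · have h2 := A.graph.sub_mem (hRg (μ • (u : H) - A u)) (A.mem_graph u)
    rw [Prod.mk_sub_mk] at h2
    refine sub_eq_zero.1 (hinj _ ?_)
    convert h2 using 2
    rw [smul_sub]
    abel

end CompactResolvent

/-! ### Absolutely continuous functions with values in a normed space -/

section AbsolutelyContinuous

variable {F : Type*} [NormedAddCommGroup F]

theorem absolutelyContinuousOnInterval_of_dist_le_add {X Y Z : Type*} [PseudoMetricSpace X]
    [PseudoMetricSpace Y] [PseudoMetricSpace Z] {f : ℝ → X} {g : ℝ → Y} {h : ℝ → Z} {a b C D : ℝ}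
    (hg : AbsolutelyContinuousOnInterval g a b) (hh : AbsolutelyContinuousOnInterval h a b)
    (H : ∀ x ∈ uIcc a b, ∀ y ∈ uIcc a b,
      dist (f x) (f y) ≤ C * dist (g x) (g y) + D * dist (h x) (h y)) :
    AbsolutelyContinuousOnInterval f a b := by
  unfold AbsolutelyContinuousOnInterval at hg hh ⊢
  refine squeeze_zero' (Eventually.of_forall fun _ => Finset.sum_nonneg fun i hi => dist_nonneg) ?_
    (by simpa using (hg.const_mul C).add (hh.const_mul D))
  rw [eventually_inf_principal]
  filter_upwards with E hE
  simp only [Finset.mul_sum, ← Finset.sum_add_distrib]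
  exact Finset.sum_le_sum fun i hi => H _ (hE.1 i hi).1 _ (hE.1 i hi).2

theorem absolutelyContinuousOnInterval_of_dist_le {X Y : Type*} [PseudoMetricSpace X]
    [PseudoMetricSpace Y] {f : ℝ → X} {h : ℝ → Y} {a b : ℝ}
    (hh : AbsolutelyContinuousOnInterval h a b)
    (hfh : ∀ x ∈ uIcc a b, ∀ y ∈ uIcc a b, dist (f x) (f y) ≤ dist (h x) (h y)) :
    AbsolutelyContinuousOnInterval f a b :=
  absolutelyContinuousOnInterval_of_dist_le_add (C := 1) (D := 0) hh hh fun x hx y hy => by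
    simpa using hfh x hx y hy

variable [NormedSpace ℝ F]

theorem dist_intervalIntegral_le {g : ℝ → F} {a b : ℝ} (hg : IntervalIntegrable g volume a b)
    {c x y : ℝ} (hc : c ∈ uIcc a b) (hx : x ∈ uIcc a b) (hy : y ∈ uIcc a b) :
    dist (∫ t in c..x, g t) (∫ t in c..y, g t) ≤
      dist (∫ t in c..x, ‖g t‖) (∫ t in c..y, ‖g t‖) := by
  have hi : ∀ {p q}, p ∈ uIcc a b → q ∈ uIcc a b → IntervalIntegrable g volume p q :=
    fun hp hq => hg.mono_set (uIcc_subset_uIcc hp hq)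
  rw [dist_eq_norm, Real.dist_eq, intervalIntegral.integral_interval_sub_left (hi hc hx) (hi hc hy),
    intervalIntegral.integral_interval_sub_left (hi hc hx).norm (hi hc hy).norm]
  exact intervalIntegral.norm_integral_le_abs_integral_norm

theorem absolutelyContinuousOnInterval_integral {g : ℝ → F} {a b c : ℝ}
    (hg : IntervalIntegrable g volume a b) (hc : c ∈ uIcc a b) :
    AbsolutelyContinuousOnInterval (fun x => ∫ t in c..x, g t) a b :=
  absolutelyContinuousOnInterval_of_dist_le
    (hg.norm.absolutelyContinuousOnInterval_intervalIntegral hc)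
    fun _ hx _ hy => dist_intervalIntegral_le hg hc hx hy

/-- The fundamental theorem of calculus for absolutely continuous functions. -/
theorem integral_eq_sub_of_absolutelyContinuous [CompleteSpace F] {f g : ℝ → F} {a b : ℝ}
    (hf : AbsolutelyContinuousOnInterval f a b) (hg : IntervalIntegrable g volume a b)
    (hd : ∀ᵐ x, x ∈ uIcc a b → HasDerivAt f (g x) x) : ∫ x in a..b, g x = f b - f a := by
  have hac : AbsolutelyContinuousOnInterval (fun x => f x - ∫ t in a..x, g t) a b :=
    hf.sub (absolutelyContinuousOnInterval_integral hg left_mem_uIcc)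
  obtain ⟨C, hC⟩ := hac.const_of_ae_hasDerivAt_zero (by
    filter_upwards [hd, hg.ae_hasDerivAt_integral] with x h1 h2 hx
    exact ((h1 hx).sub (h2 hx a left_mem_uIcc)).congr_deriv (sub_self _))
  have h1 := hC a left_mem_uIcc
  have h2 := hC b right_mem_uIcc
  simp only [intervalIntegral.integral_same, sub_zero] at h1
  rw [h1, ← h2, sub_sub_cancel]

end AbsolutelyContinuous

/-! ### Weak derivatives on an interval -/

section Sobolev

variable {F : Type*} [NormedAddCommGroup F] {ℓ : ℝ}

theorem intervalIntegrable_of_integrable_edge {g : ℝ → F} (hℓ : 0 ≤ ℓ)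
    (hg : Integrable g (edgeMeasure ℓ)) : IntervalIntegrable g volume 0 ℓ :=
  (intervalIntegrable_iff_integrableOn_Ioo_of_le hℓ).2 hg

variable [NormedSpace ℝ F]

/-- Integration by parts against test functions: an absolutely continuous function has its pointwise
derivative as weak derivative. -/
theorem hasWeakDeriv_of_absolutelyContinuous [CompleteSpace F] {f g : ℝ → F} (hℓ : 0 ≤ ℓ)
    (hf : AbsolutelyContinuousOnInterval f 0 ℓ) (hg : Integrable g (edgeMeasure ℓ))
    (hd : ∀ᵐ x, x ∈ uIcc 0 ℓ → HasDerivAt f (g x) x) : HasWeakDeriv ℓ f g := by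
  intro φ h1 h2 h3
  have hgi := intervalIntegrable_of_integrable_edge hℓ hg
  have hφd : ∀ x, HasDerivAt φ (deriv φ x) x := fun x =>
    (h1.differentiable (by simp)).differentiableAt.hasDerivAt
  have hz : ∀ x, x ∉ Ioo 0 ℓ → φ x = 0 := fun x hx =>
    image_eq_zero_of_notMem_tsupport fun hx' => hx (h3 hx')
  have hφac : AbsolutelyContinuousOnInterval φ 0 ℓ :=
    (h1.contDiffOn.of_le (by simp)).absolutelyContinuousOnInterval
  have i1 : IntervalIntegrable (fun x => φ x • g x) volume 0 ℓ :=
    hgi.continuousOn_smul h1.continuous.continuousOn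
  have i2 : IntervalIntegrable (fun x => deriv φ x • f x) volume 0 ℓ :=
    ((continuous_deriv_test h1).continuousOn.smul hf.continuousOn).intervalIntegrable
  have h := integral_eq_sub_of_absolutelyContinuous (hφac.smul hf) (i1.add i2) (by
    filter_upwards [hd] with x hx hxm
    exact (hφd x).smul (hx hxm))
  simp only [Pi.smul_apply', hz 0 (by simp), hz ℓ (by simp), zero_smul, sub_self] at h
  rw [← integral_Ioc_eq_integral_Ioo, ← integral_Ioc_eq_integral_Ioo,
    ← intervalIntegral.integral_of_le hℓ, ← intervalIntegral.integral_of_le hℓ]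
  rw [intervalIntegral.integral_add i1 i2] at h
  exact eq_neg_of_add_eq_zero_right h

/-- A smooth function with compact support in an interval and integral zero is the derivative of
a function of the same kind. -/
theorem exists_test_primitive {η : ℝ → ℝ} (h1 : ContDiff ℝ ∞ η) (h2 : HasCompactSupport η)
    (h3 : tsupport η ⊆ Ioo 0 ℓ) (h0 : ∫ x, η x = 0) :
    ∃ Φ : ℝ → ℝ, ContDiff ℝ ∞ Φ ∧ HasCompactSupport Φ ∧ tsupport Φ ⊆ Ioo 0 ℓ ∧ deriv Φ = η := by
  rcases (tsupport η).eq_empty_or_nonempty with he | hne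
  · have : η = 0 := tsupport_eq_empty_iff.1 he
    exact ⟨0, contDiff_const, HasCompactSupport.zero, by simp [tsupport], by
      rw [this]; ext x; simp⟩
  obtain ⟨a, ha, hla⟩ := h2.exists_isLeast hne
  obtain ⟨b, hb, hgb⟩ := h2.exists_isGreatest hne
  have ha0 := (h3 ha).1
  have hbℓ := (h3 hb).2
  have hz : ∀ t, t ∉ Icc a b → η t = 0 := fun t ht =>
    image_eq_zero_of_notMem_tsupport fun h => ht ⟨hla h, hgb h⟩
  have hd : ∀ x, HasDerivAt (fun x => ∫ t in (0 : ℝ)..x, η t) (η x) x := fun x =>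
    intervalIntegral.integral_hasDerivAt_right (h1.continuous.intervalIntegrable _ _)
      (h1.continuous.stronglyMeasurableAtFilter _ _) h1.continuous.continuousAt
  have hderiv : deriv (fun x => ∫ t in (0 : ℝ)..x, η t) = η := funext fun x => (hd x).deriv
  have hsupp : Function.support (fun x => ∫ t in (0 : ℝ)..x, η t) ⊆ Icc a b := by
    intro x hx
    by_contra hxab
    refine hx ?_
    rcases lt_or_ge x a with hxa | hxa
    · refine (intervalIntegral.integral_congr (g := fun _ => (0 : ℝ)) fun t ht => ?_).trans
        (by simp)
      refine hz t fun h => ?_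
      rcases mem_uIcc.1 ht with h' | h' <;> linarith [h.1]
    · have hxb : b < x := by
        by_contra hh
        exact hxab ⟨hxa, not_lt.1 hh⟩
      change ∫ t in (0 : ℝ)..x, η t = 0
      rw [intervalIntegral.integral_eq_integral_of_support_subset, h0]
      intro t ht
      have : t ∈ Icc a b := by
        by_contra hh
        exact ht (hz t hh)
      exact ⟨ha0.trans_le this.1, this.2.trans hxb.le⟩
  have hts : tsupport (fun x => ∫ t in (0 : ℝ)..x, η t) ⊆ Icc a b :=
    closure_minimal hsupp isClosed_Icc
  refine ⟨fun x => ∫ t in (0 : ℝ)..x, η t, ?_, ?_, ?_, hderiv⟩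
  · rw [contDiff_infty_iff_deriv, hderiv]
    exact ⟨fun x => (hd x).differentiableAt, h1⟩
  · exact isCompact_Icc.of_isClosed_subset (isClosed_tsupport _) hts
  · exact hts.trans fun x hx => ⟨ha0.trans_le hx.1, hx.2.trans_lt hbℓ⟩

/-- The lemma of du Bois-Reymond. -/
theorem ae_eq_const_of_hasWeakDeriv_zero [CompleteSpace F] {u : ℝ → F} (hℓ : 0 < ℓ)
    (hu : Integrable u (edgeMeasure ℓ)) (h : HasWeakDeriv ℓ u 0) :
    ∃ C : F, u =ᵐ[edgeMeasure ℓ] fun _ => C := by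
  have hti : ∀ {φ : ℝ → ℝ} {v : ℝ → F}, Continuous φ → HasCompactSupport φ →
      Integrable v (edgeMeasure ℓ) → Integrable (fun x => φ x • v x) (edgeMeasure ℓ) := by
    intro φ v hc hs hv
    obtain ⟨C, hC⟩ := hs.exists_bound_of_continuous hc
    exact hv.bdd_smul C hc.aestronglyMeasurable (Eventually.of_forall hC)
  let b : ContDiffBump (ℓ / 2) := ⟨ℓ / 8, ℓ / 4, by positivity, by linarith⟩
  set ψ := b.normed volume with hψ
  have hψ1 : ContDiff ℝ ∞ ψ := b.contDiff_normed
  have hψ2 : HasCompactSupport ψ := b.hasCompactSupport_normed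
  have hψ3 : tsupport ψ ⊆ Ioo 0 ℓ := by
    rw [hψ, b.tsupport_normed_eq, Real.closedBall_eq_Icc]
    intro x hx
    change x ∈ Icc (ℓ / 2 - ℓ / 4) (ℓ / 2 + ℓ / 4) at hx
    exact ⟨by linarith [hx.1], by linarith [hx.2]⟩
  have hψI : ∫ x, ψ x = 1 := b.integral_normed
  refine ⟨∫ x in Ioo 0 ℓ, ψ x • u x, ?_⟩
  set C := ∫ x in Ioo 0 ℓ, ψ x • u x with hC
  have key : ∀ᵐ x ∂volume, x ∈ Ioo 0 ℓ → (fun x => u x - C) x = 0 := by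
    refine isOpen_Ioo.ae_eq_zero_of_integral_contDiff_smul_eq_zero
      (IntegrableOn.locallyIntegrableOn (hu.sub (integrable_const C))) ?_
    intro φ h1 h2 h3
    have hz : ∀ x, x ∉ Ioo 0 ℓ → φ x = 0 := fun x hx =>
      image_eq_zero_of_notMem_tsupport fun hx' => hx (h3 hx')
    set I := ∫ x, φ x with hI
    have i0 : ∫ x, (φ x - I * ψ x) = 0 := by
      rw [integral_sub (h1.continuous.integrable_of_hasCompactSupport h2)
        ((hψ1.continuous.integrable_of_hasCompactSupport hψ2).const_mul I), integral_const_mul,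
        hψI, mul_one, sub_self]
    have hη : Function.support (fun x => φ x - I * ψ x) ⊆ tsupport φ ∪ tsupport ψ := by
      intro x hx
      by_contra hh
      rw [mem_union, not_or] at hh
      refine hx ?_
      simp [image_eq_zero_of_notMem_tsupport hh.1, image_eq_zero_of_notMem_tsupport hh.2]
    have hts : tsupport (fun x => φ x - I * ψ x) ⊆ tsupport φ ∪ tsupport ψ :=
      closure_minimal hη ((isClosed_tsupport _).union (isClosed_tsupport _))
    obtain ⟨Φ, hΦ1, hΦ2, hΦ3, hΦ4⟩ := exists_test_primitive (ℓ := ℓ)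
      (h1.sub (contDiff_const.mul hψ1))
      ((h2.isCompact.union hψ2.isCompact).of_isClosed_subset (isClosed_tsupport _) hts)
      (hts.trans (union_subset h3 hψ3)) i0
    have e := h Φ hΦ1 hΦ2 hΦ3
    simp only [hΦ4, Pi.zero_apply, smul_zero, integral_zero, neg_zero, sub_smul, mul_smul] at e
    rw [integral_sub (g := fun x => I • ψ x • u x) (hti h1.continuous h2 hu)
      ((hti hψ1.continuous hψ2 hu).smul I), integral_smul, ← hC] at e
    rw [← setIntegral_eq_integral_of_forall_compl_eq_zero (s := Ioo 0 ℓ)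
      (fun x hx => by rw [hz x hx, zero_smul])]
    simp only [smul_sub]
    rw [integral_sub (hti h1.continuous h2 hu) (hti h1.continuous h2 (integrable_const C)),
      integral_smul_const, setIntegral_eq_integral_of_forall_compl_eq_zero hz]
    exact e
  refine (ae_restrict_iff' measurableSet_Ioo).2 ?_
  filter_upwards [key] with x hx hxm
  exact sub_eq_zero.1 (hx hxm)

end Sobolev

/-! ### The Sobolev space `H¹` on an edge -/

section EdgeSobolev

variable {ℓ : ℝ} {k : ℕ}

theorem integrable_edge (u : EdgeL2 ℓ k) : Integrable u (edgeMeasure ℓ) :=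
  (Lp.memLp u).integrable (by norm_num)

theorem intervalIntegrable_edge (hℓ : 0 ≤ ℓ) (u : EdgeL2 ℓ k) : IntervalIntegrable u volume 0 ℓ :=
  intervalIntegrable_of_integrable_edge hℓ (integrable_edge u)

theorem continuousOn_primitive (hℓ : 0 ≤ ℓ) (g : EdgeL2 ℓ k) :
    ContinuousOn (fun x => ∫ t in (0 : ℝ)..x, g t) (Icc 0 ℓ) := by
  rw [← uIcc_of_le hℓ]
  exact (absolutelyContinuousOnInterval_integral (intervalIntegrable_edge hℓ g)
    left_mem_uIcc).continuousOn

theorem hasWeakDeriv_primitive (hℓ : 0 ≤ ℓ) (g : EdgeL2 ℓ k) (c : EdgeVec k) :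
    HasWeakDeriv ℓ (fun x => c + ∫ t in (0 : ℝ)..x, g t) g := by
  have hg := intervalIntegrable_edge hℓ g
  refine hasWeakDeriv_of_absolutelyContinuous hℓ ?_ (integrable_edge g) ?_
  · refine absolutelyContinuousOnInterval_of_dist_le
      (hg.norm.absolutelyContinuousOnInterval_intervalIntegral left_mem_uIcc)
      fun x hx y hy => ?_
    rw [dist_add_left]
    exact dist_intervalIntegral_le hg left_mem_uIcc hx hy
  · filter_upwards [hg.ae_hasDerivAt_integral] with x hx hxm
    exact (hx hxm 0 left_mem_uIcc).const_add c

theorem HasWeakDeriv.congr_ae {F : Type*} [NormedAddCommGroup F] [NormedSpace ℝ F]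
    {u v g : ℝ → F} (h : HasWeakDeriv ℓ u g) (huv : u =ᵐ[edgeMeasure ℓ] v) :
    HasWeakDeriv ℓ v g := by
  intro φ h1 h2 h3
  rw [← h φ h1 h2 h3]
  refine integral_congr_ae ?_
  filter_upwards [huv] with x hx
  rw [hx]

/-- The continuous representative is the integral of the weak derivative. -/
theorem IsContRep.eq_add_integral {u g : EdgeL2 ℓ k} {w : ℝ → EdgeVec k} (hℓ : 0 < ℓ)
    (hw : IsContRep u w) (hu : HasWeakDeriv ℓ u g) {x : ℝ} (hx : x ∈ Icc 0 ℓ) :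
    w x = w 0 + ∫ t in (0 : ℝ)..x, g t := by
  have hcont := continuousOn_primitive hℓ.le g
  have hint : Integrable (fun x => ∫ t in (0 : ℝ)..x, g t) (edgeMeasure ℓ) :=
    (hcont.integrableOn_Icc).mono_set Ioo_subset_Icc_self
  have hprim := hasWeakDeriv_primitive hℓ.le g 0
  simp only [zero_add] at hprim
  have h0 : HasWeakDeriv ℓ (fun x => u x - ∫ t in (0 : ℝ)..x, g t) 0 := by
    intro φ h1 h2 h3
    have hb : ∀ {v : ℝ → EdgeVec k}, Integrable v (edgeMeasure ℓ) →
        Integrable (fun x => deriv φ x • v x) (edgeMeasure ℓ) := by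
      intro v hv
      obtain ⟨C, hC⟩ := h2.deriv.exists_bound_of_continuous (continuous_deriv_test h1)
      exact hv.bdd_smul C (continuous_deriv_test h1).aestronglyMeasurable
        (Eventually.of_forall hC)
    simp only [smul_sub]
    rw [integral_sub (hb (integrable_edge u)) (hb hint), hu φ h1 h2 h3, hprim φ h1 h2 h3]
    simp
  obtain ⟨C, hC⟩ := ae_eq_const_of_hasWeakDeriv_zero hℓ ((integrable_edge u).sub hint) h0
  have hae : w =ᵐ[edgeMeasure ℓ] fun x => C + ∫ t in (0 : ℝ)..x, g t := by
    filter_upwards [hC, hw.2] with x h1 h2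
    rw [← h2, ← h1, Pi.sub_apply, sub_add_cancel]
  have heqo : EqOn w (fun x => C + ∫ t in (0 : ℝ)..x, g t) (Ioo 0 ℓ) :=
    Measure.eqOn_open_of_ae_eq hae isOpen_Ioo (hw.1.mono Ioo_subset_Icc_self)
      ((continuousOn_const.add hcont).mono Ioo_subset_Icc_self)
  have heq : EqOn w (fun x => C + ∫ t in (0 : ℝ)..x, g t) (Icc 0 ℓ) :=
    heqo.of_subset_closure hw.1 (continuousOn_const.add hcont) Ioo_subset_Icc_self
      (by rw [closure_Ioo hℓ.ne])
  have e0 := heq (left_mem_Icc.2 hℓ.le)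
  simp only [intervalIntegral.integral_same, add_zero] at e0
  rw [e0]
  exact heq hx

end EdgeSobolev

/-! ### The Volterra operator -/

section Volterra

variable {ℓ : ℝ} {k : ℕ}

theorem norm_setIntegral_edge_le (g : EdgeL2 ℓ k) {s : Set ℝ} (hs : MeasurableSet s) :
    ‖∫ t in s, g t ∂edgeMeasure ℓ‖ ≤ √((edgeMeasure ℓ).real s) * ‖g‖ := by
  set c := ∫ t in s, g t ∂edgeMeasure ℓ with hc
  have h1 := L2.inner_indicatorConstLp_eq_inner_setIntegral (𝕜 := ℂ) hs
    (measure_ne_top (edgeMeasure ℓ) s) c g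
  have h2 := norm_inner_le_norm (𝕜 := ℂ)
    (indicatorConstLp 2 hs (measure_ne_top (edgeMeasure ℓ) s) c) g
  rw [h1, ← hc, inner_self_eq_norm_sq_to_K, norm_indicatorConstLp (by norm_num) (by norm_num)] at h2
  have h3 : ‖c‖ * ‖c‖ ≤ √((edgeMeasure ℓ).real s) * ‖g‖ * ‖c‖ := by
    have e : (1 : ℝ) / (2 : ℝ≥0∞).toReal = 1 / 2 := by simp
    rw [e, ← Real.sqrt_eq_rpow] at h2
    simp only [norm_pow, RCLike.norm_ofReal, abs_norm] at h2
    linarith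
  rcases (norm_nonneg c).eq_or_lt with h | h
  · rw [← h]; positivity
  · exact le_of_mul_le_mul_right h3 h

/-- The functional `g ↦ ∫₀ˣ g dt` on `L²(0, ℓ)^k`, for `x ∈ [0, ℓ]`. -/
def primitiveAt (ℓ : ℝ) (k : ℕ) (x : ℝ) : EdgeL2 ℓ k →L[ℂ] EdgeVec k :=
  LinearMap.mkContinuous
    { toFun := fun g => ∫ t in Iic x, g t ∂edgeMeasure ℓ
      map_add' := fun g h => by
        rw [← integral_add (integrable_edge g).restrict (integrable_edge h).restrict]
        exact integral_congr_ae (ae_restrict_of_ae (Lp.coeFn_add g h))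
      map_smul' := fun c g => by
        rw [RingHom.id_apply, ← integral_smul]
        exact integral_congr_ae (ae_restrict_of_ae (Lp.coeFn_smul c g)) }
    (√((edgeMeasure ℓ).real (Iic x))) fun g => norm_setIntegral_edge_le g measurableSet_Iic

theorem primitiveAt_apply (x : ℝ) (g : EdgeL2 ℓ k) :
    primitiveAt ℓ k x g = ∫ t in Iic x, g t ∂edgeMeasure ℓ := rfl

theorem primitiveAt_eq_intervalIntegral (g : EdgeL2 ℓ k) {x : ℝ} (hx : x ∈ Icc 0 ℓ) :
    primitiveAt ℓ k x g = ∫ t in (0 : ℝ)..x, g t := by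
  rw [primitiveAt_apply, Measure.restrict_restrict measurableSet_Iic,
    intervalIntegral.integral_of_le hx.1]
  refine setIntegral_congr_set ?_
  have h1 : Iic x ∩ Ioc 0 ℓ = Ioc 0 x := by
    ext t
    simp only [mem_inter_iff, mem_Iic, mem_Ioc]
    constructor
    · rintro ⟨a, b, c⟩; exact ⟨b, a⟩
    · rintro ⟨a, b⟩; exact ⟨b, a, b.trans hx.2⟩
  rw [← h1]
  exact (ae_eq_refl _).inter Ioo_ae_eq_Ioc

theorem norm_primitiveAt_sub_le (g : EdgeL2 ℓ k) (x y : ℝ) :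
    ‖primitiveAt ℓ k x g - primitiveAt ℓ k y g‖ ≤ √|x - y| * ‖g‖ := by
  wlog hxy : y ≤ x generalizing x y
  · rw [norm_sub_rev, abs_sub_comm]
    exact this y x (le_of_not_ge hxy)
  have e : primitiveAt ℓ k x g - primitiveAt ℓ k y g = ∫ t in Ioc y x, g t ∂edgeMeasure ℓ := by
    rw [primitiveAt_apply, primitiveAt_apply, ← Iic_union_Ioc_eq_Iic hxy,
      setIntegral_union (Iic_disjoint_Ioc le_rfl) measurableSet_Ioc
        (integrable_edge g).integrableOn (integrable_edge g).integrableOn, add_sub_cancel_left]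
  rw [e]
  refine (norm_setIntegral_edge_le g measurableSet_Ioc).trans ?_
  gcongr
  rw [abs_of_nonneg (sub_nonneg.2 hxy), ← Real.volume_real_Ioc_of_le hxy]
  exact ENNReal.toReal_mono (by simp) (Measure.restrict_apply_le _ _)

theorem continuous_primitiveAt (g : EdgeL2 ℓ k) : Continuous fun x => primitiveAt ℓ k x g := by
  rw [continuous_iff_continuousAt]
  intro x
  rw [ContinuousAt, tendsto_iff_norm_sub_tendsto_zero]
  refine squeeze_zero (fun _ => norm_nonneg _) (fun y => norm_primitiveAt_sub_le g y x) ?_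
  have : Continuous fun y : ℝ => √|y - x| * ‖g‖ := by fun_prop
  simpa using this.tendsto x

theorem norm_primitiveAt_le (g : EdgeL2 ℓ k) (x : ℝ) :
    ‖primitiveAt ℓ k x g‖ ≤ √((edgeMeasure ℓ).real univ) * ‖g‖ :=
  (norm_setIntegral_edge_le g measurableSet_Iic).trans (by
    gcongr
    · exact measure_ne_top _ _
    · exact subset_univ _)

theorem memLp_primitive (g : EdgeL2 ℓ k) :
    MemLp (fun x => primitiveAt ℓ k x g) 2 (edgeMeasure ℓ) :=
  MemLp.of_bound (continuous_primitiveAt g).aestronglyMeasurable _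
    (Eventually.of_forall (norm_primitiveAt_le g))

/-- The Volterra operator, which maps `g` to `x ↦ ∫₀ˣ g dt`. -/
def volterra (ℓ : ℝ) (k : ℕ) : EdgeL2 ℓ k →L[ℂ] EdgeL2 ℓ k :=
  LinearMap.mkContinuous
    { toFun := fun g => (memLp_primitive g).toLp
      map_add' := fun g h => by
        rw [← MemLp.toLp_add]
        exact MemLp.toLp_congr _ _ (Eventually.of_forall fun x => map_add _ g h)
      map_smul' := fun c g => by
        rw [RingHom.id_apply, ← MemLp.toLp_const_smul]
        exact MemLp.toLp_congr _ _ (Eventually.of_forall fun x => map_smul _ c g) }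
    ((edgeMeasure ℓ).real univ ^ (2 : ℝ≥0∞).toReal⁻¹ * √((edgeMeasure ℓ).real univ)) fun g => by
      rw [mul_assoc]
      refine Lp.norm_le_of_ae_bound (by positivity) ?_
      filter_upwards [(memLp_primitive g).coeFn_toLp] with x hx
      refine (congrArg norm hx).trans_le ?_
      exact norm_primitiveAt_le g x

theorem coeFn_volterra (g : EdgeL2 ℓ k) :
    volterra ℓ k g =ᵐ[edgeMeasure ℓ] fun x => primitiveAt ℓ k x g :=
  (memLp_primitive g).coeFn_toLp

theorem memLp_step {n : ℕ} {idx : ℝ → Fin n} (hidx : Measurable idx) (c : Fin n → EdgeVec k) :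
    MemLp (fun x => c (idx x)) 2 (edgeMeasure ℓ) :=
  MemLp.of_bound ((measurable_of_countable c).comp hidx).aestronglyMeasurable ‖c‖
    (Eventually.of_forall fun x => norm_le_pi_norm c (idx x))

/-- The step function with value `c i` where `idx = i`. -/
def stepLp (ℓ : ℝ) (k : ℕ) {n : ℕ} {idx : ℝ → Fin n} (hidx : Measurable idx) :
    (Fin n → EdgeVec k) →ₗ[ℂ] EdgeL2 ℓ k where
  toFun c := (memLp_step hidx c).toLp
  map_add' c d := by
    rw [← MemLp.toLp_add]
    exact MemLp.toLp_congr _ _ (Eventually.of_forall fun x => rfl)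
  map_smul' r c := by
    rw [RingHom.id_apply, ← MemLp.toLp_const_smul]
    exact MemLp.toLp_congr _ _ (Eventually.of_forall fun x => rfl)

theorem coeFn_stepLp {n : ℕ} {idx : ℝ → Fin n} (hidx : Measurable idx) (c : Fin n → EdgeVec k) :
    stepLp ℓ k hidx c =ᵐ[edgeMeasure ℓ] fun x => c (idx x) :=
  (memLp_step hidx c).coeFn_toLp

theorem isCompactOperator_of_finiteDimensional {X Y : Type*} [NormedAddCommGroup X]
    [NormedSpace ℂ X] [NormedAddCommGroup Y] [NormedSpace ℂ Y] [FiniteDimensional ℂ Y]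
    (f : X →L[ℂ] Y) : IsCompactOperator f := by
  have h : IsCompactOperator (id : Y → Y) :=
    (isCompactOperator_id_iff_finiteDimensional (𝕜 := ℂ)).2 inferInstance
  exact h.comp_clm f

/-- The Volterra operator is the norm limit of the operators of finite rank that replace the
primitive by its values on a grid. -/
theorem isCompactOperator_volterra (hℓ : 0 < ℓ) : IsCompactOperator (volterra ℓ k) := by
  let idx : (n : ℕ) → ℝ → Fin (n + 1) := fun n x => Fin.ofNat (n + 1) ⌊(n + 1) * x / ℓ⌋₊
  have hidx : ∀ n, Measurable (idx n) := fun n =>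
    (measurable_of_countable (Fin.ofNat (n + 1))).comp (Nat.measurable_floor.comp
      ((measurable_id.const_mul ((n : ℝ) + 1)).div_const ℓ))
  let pt : (n : ℕ) → Fin (n + 1) → ℝ := fun n j => j * ℓ / (n + 1)
  let V : ℕ → EdgeL2 ℓ k →L[ℂ] EdgeL2 ℓ k := fun n =>
    (stepLp ℓ k (hidx n)).toContinuousLinearMap.comp
      (ContinuousLinearMap.pi fun j => primitiveAt ℓ k (pt n j))
  have hpt : ∀ n, ∀ x ∈ Ioo 0 ℓ, |x - pt n (idx n x)| ≤ ℓ / (n + 1) := by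
    intro n x hx
    have hn : (0 : ℝ) < n + 1 := by positivity
    set y := (n + 1) * x / ℓ with hy
    have hy0 : 0 ≤ y := by have := hx.1; positivity
    have hyn : y < n + 1 := by
      rw [hy, div_lt_iff₀ hℓ]
      exact mul_lt_mul_of_pos_left hx.2 hn
    have hfl : ⌊y⌋₊ < n + 1 := by
      rw [Nat.floor_lt hy0]; exact_mod_cast hyn
    have hval : ((idx n x : Fin (n + 1)) : ℕ) = ⌊y⌋₊ := Nat.mod_eq_of_lt hfl
    have h1 := Nat.floor_le hy0
    have h2 := Nat.lt_floor_add_one y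
    have hx' : x = y * (ℓ / (n + 1)) := by rw [hy]; field_simp
    have e : x - pt n (idx n x) = (y - ⌊y⌋₊) * (ℓ / (n + 1)) := by
      simp only [pt, hval]
      nth_rewrite 1 [hx']
      ring
    rw [e, abs_of_nonneg (mul_nonneg (by linarith) (by positivity))]
    have : 0 ≤ ℓ / (n + 1) := by positivity
    nlinarith
  have hb : ∀ n, ‖V n - volterra ℓ k‖ ≤
      (edgeMeasure ℓ).real univ ^ (2 : ℝ≥0∞).toReal⁻¹ * √(ℓ / (n + 1)) := by
    intro n
    refine ContinuousLinearMap.opNorm_le_bound _ (by positivity) fun g => ?_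
    rw [mul_assoc]
    refine Lp.norm_le_of_ae_bound (by positivity) ?_
    filter_upwards [coeFn_volterra g, coeFn_stepLp (hidx n) (fun j => primitiveAt ℓ k (pt n j) g),
      Lp.coeFn_sub (V n g) (volterra ℓ k g), ae_restrict_mem measurableSet_Ioo] with x h1 h2 h3 hx
    have h2' : V n g x = primitiveAt ℓ k (pt n (idx n x)) g := h2
    rw [sub_apply, h3, Pi.sub_apply, h1, h2', norm_sub_rev]
    refine (norm_primitiveAt_sub_le g _ _).trans ?_
    gcongr
    exact hpt n x hx
  have hlim : Tendsto V atTop (𝓝 (volterra ℓ k)) := by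
    rw [tendsto_iff_norm_sub_tendsto_zero]
    refine squeeze_zero (fun _ => norm_nonneg _) hb ?_
    have h1 : Tendsto (fun n : ℕ => ℓ / ((n : ℝ) + 1)) atTop (𝓝 0) :=
      (tendsto_atTop_add_const_right _ 1 tendsto_natCast_atTop_atTop).const_div_atTop ℓ
    simpa using ((Real.continuous_sqrt.tendsto 0).comp h1).const_mul
      ((edgeMeasure ℓ).real univ ^ (2 : ℝ≥0∞).toReal⁻¹)
  refine isCompactOperator_of_tendsto hlim (Eventually.of_forall fun n => ?_)
  exact (isCompactOperator_of_finiteDimensional _).clm_comp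
    (stepLp ℓ k (hidx n)).toContinuousLinearMap

theorem coeFn_volterra_add_const (g : EdgeL2 ℓ k) (c : EdgeVec k) :
    (volterra ℓ k g + Lp.constL 2 (edgeMeasure ℓ) ℂ c : EdgeL2 ℓ k) =ᵐ[edgeMeasure ℓ]
      fun x => c + ∫ t in (0 : ℝ)..x, g t := by
  filter_upwards [coeFn_volterra g, Lp.coeFn_const (p := 2) (μ := edgeMeasure ℓ) c,
    Lp.coeFn_add (volterra ℓ k g) (Lp.constL 2 (edgeMeasure ℓ) ℂ c),
    ae_restrict_mem measurableSet_Ioo] with x h1 h2 h3 hx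
  have h2' : Lp.constL 2 (edgeMeasure ℓ) ℂ c x = c := h2
  rw [h3, Pi.add_apply, h1, h2', primitiveAt_eq_intervalIntegral g (Ioo_subset_Icc_self hx),
    add_comm]

theorem hasWeakDeriv_volterra (hℓ : 0 ≤ ℓ) (g : EdgeL2 ℓ k) (c : EdgeVec k) :
    HasWeakDeriv ℓ (volterra ℓ k g + Lp.constL 2 (edgeMeasure ℓ) ℂ c : EdgeL2 ℓ k) g :=
  (hasWeakDeriv_primitive hℓ g c).congr_ae (coeFn_volterra_add_const g c).symm

theorem isContRep_volterra (hℓ : 0 ≤ ℓ) (g : EdgeL2 ℓ k) (c : EdgeVec k) :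
    IsContRep (volterra ℓ k g + Lp.constL 2 (edgeMeasure ℓ) ℂ c : EdgeL2 ℓ k)
      fun x => c + ∫ t in (0 : ℝ)..x, g t :=
  ⟨continuousOn_const.add (continuousOn_primitive hℓ g), coeFn_volterra_add_const g c⟩

end Volterra

/-! ### The energy estimate on an edge -/

section EdgeEnergy

variable {F : Type*} [NormedAddCommGroup F] [InnerProductSpace ℂ F]
  {ℓ : ℝ} {K : ℝ≥0} {T : ℝ → F →L[ℝ] F} {v g : ℝ → F}

theorem absolutelyContinuousOnInterval_quadratic {a b : ℝ}
    (hT : AbsolutelyContinuousOnInterval T a b)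
    (hv : AbsolutelyContinuousOnInterval v a b) :
    AbsolutelyContinuousOnInterval (fun x => (inner ℂ (v x) (T x (v x))).re) a b := by
  obtain ⟨C, hC⟩ := hv.exists_bound
  obtain ⟨D, hD⟩ := hT.exists_bound
  refine absolutelyContinuousOnInterval_of_dist_le_add (C := 2 * C * D) (D := C * C) hv hT ?_
  intro x hx y hy
  have hC0 : 0 ≤ C := (norm_nonneg _).trans (hC x hx)
  have hD0 : 0 ≤ D := (norm_nonneg _).trans (hD x hx)
  have hin : ∀ a b : F, |(inner ℂ a b).re| ≤ ‖a‖ * ‖b‖ := fun a b =>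
    (Complex.abs_re_le_norm _).trans (norm_inner_le_norm _ _)
  have e : (inner ℂ (v x) (T x (v x))).re - (inner ℂ (v y) (T y (v y))).re =
      (inner ℂ (v x - v y) (T x (v x))).re + (inner ℂ (v y) ((T x - T y) (v x))).re +
        (inner ℂ (v y) (T y (v x - v y))).re := by
    simp only [inner_sub_left, inner_sub_right, Complex.sub_re, map_sub, sub_apply]
    ring
  rw [Real.dist_eq, e, dist_eq_norm, dist_eq_norm]
  have n1 : ‖T x (v x)‖ ≤ D * C := ((T x).le_opNorm _).trans
    (mul_le_mul (hD x hx) (hC x hx) (norm_nonneg _) hD0)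
  have n2 : ‖(T x - T y) (v x)‖ ≤ ‖T x - T y‖ * C := ((T x - T y).le_opNorm _).trans
    (mul_le_mul_of_nonneg_left (hC x hx) (norm_nonneg _))
  have n3 : ‖T y (v x - v y)‖ ≤ D * ‖v x - v y‖ := (T y).le_of_opNorm_le (hD y hy) _
  have m1 := (hin (v x - v y) (T x (v x))).trans (mul_le_mul_of_nonneg_left n1 (norm_nonneg _))
  have m2 := (hin (v y) ((T x - T y) (v x))).trans (mul_le_mul (hC y hy) n2 (norm_nonneg _) hC0)
  have m3 := (hin (v y) (T y (v x - v y))).trans (mul_le_mul (hC y hy) n3 (norm_nonneg _) hC0)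
  refine (abs_add_three _ _ _).trans ?_
  linarith

/-- Integration by parts for a quadratic form with symmetric Lipschitz coefficients; the term with
the derivative of the coefficients is estimated by the Lipschitz constant. -/
theorem abs_two_mul_integral_sub_le [FiniteDimensional ℂ F] (hℓ : 0 ≤ ℓ) (hT : LipschitzWith K T)
    (hsymm : ∀ x, ∀ a b : F, (inner ℂ a (T x b)).re = (inner ℂ (T x a) b).re)
    (hv : AbsolutelyContinuousOnInterval v 0 ℓ)
    (hd : ∀ᵐ x, x ∈ uIcc 0 ℓ → HasDerivAt v (g x) x)
    (hint : Integrable (fun x => (inner ℂ (v x) (T x (g x))).re) (edgeMeasure ℓ)) :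
    |2 * (∫ x in Ioo 0 ℓ, (inner ℂ (v x) (T x (g x))).re) -
      ((inner ℂ (v ℓ) (T ℓ (v ℓ))).re - (inner ℂ (v 0) (T 0 (v 0))).re)| ≤
      K * ∫ x in Ioo 0 ℓ, ‖v x‖ ^ 2 := by
  set f : ℝ → ℝ := fun x => (inner ℂ (v x) (T x (v x))).re with hf
  have hfac : AbsolutelyContinuousOnInterval f 0 ℓ :=
    absolutelyContinuousOnInterval_quadratic
      (hT.lipschitzOnWith.absolutelyContinuousOnInterval) hv
  have := FiniteDimensional.complexToReal F
  have hTd : ∀ᵐ x, DifferentiableAt ℝ T x := hT.ae_differentiableAt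
  have hfd : ∀ᵐ x, x ∈ Ioo 0 ℓ →
      |2 * (inner ℂ (v x) (T x (g x))).re - deriv f x| ≤ K * ‖v x‖ ^ 2 := by
    filter_upwards [hd, hTd] with x h1 h2 hx
    have h1 := h1 (by rw [uIcc_of_le hℓ]; exact Ioo_subset_Icc_self hx)
    have h3 := Complex.reCLM.hasFDerivAt.comp_hasDerivAt x
      (h1.inner ℂ (h2.hasDerivAt.clm_apply h1))
    have h4 : deriv f x = (inner ℂ (v x) (deriv T x (v x) + T x (g x)) +
        inner ℂ (g x) (T x (v x))).re := h3.deriv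
    have h5 : (inner ℂ (g x) (T x (v x))).re = (inner ℂ (v x) (T x (g x))).re := by
      rw [hsymm, ← inner_conj_symm, Complex.conj_re]
    have e : 2 * (inner ℂ (v x) (T x (g x))).re - deriv f x =
        -(inner ℂ (v x) (deriv T x (v x))).re := by
      rw [h4, inner_add_right, Complex.add_re, Complex.add_re, h5]
      ring
    rw [e, abs_neg]
    have hK : ‖deriv T x‖ ≤ K := norm_deriv_le_of_lipschitz hT
    calc |(inner ℂ (v x) (deriv T x (v x))).re| ≤ ‖v x‖ * ‖deriv T x (v x)‖ :=
          (Complex.abs_re_le_norm _).trans (norm_inner_le_norm _ _)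
      _ ≤ ‖v x‖ * (K * ‖v x‖) := by
          gcongr
          exact (deriv T x).le_of_opNorm_le hK _
      _ = K * ‖v x‖ ^ 2 := by ring
  have hfi : Integrable (deriv f) (edgeMeasure ℓ) :=
    (intervalIntegrable_iff_integrableOn_Ioo_of_le hℓ).1 hfac.intervalIntegrable_deriv
  have hftc : ∫ x in Ioo 0 ℓ, deriv f x = f ℓ - f 0 := by
    rw [← hfac.integral_deriv_eq_sub, intervalIntegral.integral_of_le hℓ,
      integral_Ioc_eq_integral_Ioo]
  have hv2 : Integrable (fun x => ‖v x‖ ^ 2) (edgeMeasure ℓ) := by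
    have hc : ContinuousOn (fun x => ‖v x‖ ^ 2) (Icc 0 ℓ) := by
      have := hv.continuousOn
      rw [uIcc_of_le hℓ] at this
      exact this.norm.pow 2
    exact hc.integrableOn_Icc.mono_set Ioo_subset_Icc_self
  rw [← hftc, ← integral_const_mul, ← integral_sub (hint.const_mul 2) hfi, ← integral_const_mul]
  refine norm_integral_le_of_norm_le (μ := edgeMeasure ℓ)
    (f := fun x => 2 * (inner ℂ (v x) (T x (g x))).re - deriv f x) (hv2.const_mul (K : ℝ)) ?_
  exact (ae_restrict_iff' measurableSet_Ioo).2 hfd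

end EdgeEnergy

section EdgeL2Energy

variable {ℓ : ℝ} {k : ℕ} {K : ℝ≥0} {S : ℝ → Matrix (Fin k) (Fin k) ℂ}

/-- The action of a matrix on `ℂ^k`, as a real operator. -/
def matrixCLM (k : ℕ) (A : Matrix (Fin k) (Fin k) ℂ) : EdgeVec k →L[ℝ] EdgeVec k :=
  (Matrix.toEuclideanCLM (n := Fin k) (𝕜 := ℂ) A).restrictScalars ℝ

theorem matrixCLM_apply (A : Matrix (Fin k) (Fin k) ℂ) (x : EdgeVec k) :
    matrixCLM k A x = WithLp.toLp 2 (A *ᵥ x.ofLp) := rfl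

theorem dist_matrixCLM (A B : Matrix (Fin k) (Fin k) ℂ) :
    dist (matrixCLM k A) (matrixCLM k B) = dist A B := by
  rw [dist_eq_norm, dist_eq_norm, ← Matrix.l2_opNorm_toEuclideanCLM, map_sub]
  exact ContinuousLinearMap.norm_restrictScalars (𝕜' := ℝ)
    (Matrix.toEuclideanCLM (n := Fin k) (𝕜 := ℂ) A - Matrix.toEuclideanCLM (n := Fin k) (𝕜 := ℂ) B)

theorem inner_matrixCLM (A : Matrix (Fin k) (Fin k) ℂ) (x y : EdgeVec k) :
    inner ℂ x (matrixCLM k A y) = (A *ᵥ y.ofLp) ⬝ᵥ star x.ofLp := by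
  rw [matrixCLM_apply, EuclideanSpace.inner_eq_star_dotProduct]

theorem inner_matrixCLM_comm {A : Matrix (Fin k) (Fin k) ℂ} (hA : A.IsHermitian)
    (x y : EdgeVec k) : inner ℂ x (matrixCLM k A y) = inner ℂ (matrixCLM k A x) y := by
  rw [inner_matrixCLM, EuclideanSpace.inner_eq_star_dotProduct, matrixCLM_apply, Matrix.star_mulVec,
    hA.eq, dotProduct_comm, Matrix.dotProduct_mulVec, dotProduct_comm]

theorem integral_norm_sq_edge (u : EdgeL2 ℓ k) : ∫ x in Ioo 0 ℓ, ‖u x‖ ^ 2 = ‖u‖ ^ 2 := by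
  have h : inner ℂ u u = ∫ x in Ioo 0 ℓ, inner ℂ (u x) (u x) := L2.inner_def u u
  simp only [inner_self_eq_norm_sq_to_K] at h
  have h2 : ((‖u‖ ^ 2 : ℝ) : ℂ) = ((∫ x in Ioo 0 ℓ, ‖u x‖ ^ 2 : ℝ) : ℂ) := by
    rw [← integral_complex_ofReal]
    push_cast
    exact h
  exact_mod_cast h2.symm

/-- The energy estimate on an edge: the boundary terms represent `2 Re (u, S g)` up to a multiple of
`‖u‖²`, for `u ∈ H¹` with weak derivative `g` and continuous
representative `w`. Here `h = S g`. -/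
theorem abs_two_mul_inner_sub_le (hℓ : 0 < ℓ) (hS : LipschitzOnWith K S (Icc 0 ℓ))
    (hH : ∀ x ∈ Icc 0 ℓ, (S x).IsHermitian) {u g h : EdgeL2 ℓ k} {w : ℝ → EdgeVec k}
    (hu : HasWeakDeriv ℓ u g) (hw : IsContRep u w)
    (hh : h =ᵐ[edgeMeasure ℓ] fun x => matrixCLM k (S x) (g x)) :
    |2 * (inner ℂ u h).re - ((inner ℂ (w ℓ) (matrixCLM k (S ℓ) (w ℓ))).re -
      (inner ℂ (w 0) (matrixCLM k (S 0) (w 0))).re)| ≤ K * ‖u‖ ^ 2 := by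
  -- The coefficients are extended from `[0, ℓ]` to the line by constants.
  set T : ℝ → EdgeVec k →L[ℝ] EdgeVec k := fun x => matrixCLM k (S (projIcc 0 ℓ hℓ.le x)) with hT
  have hTx : ∀ x ∈ Icc 0 ℓ, T x = matrixCLM k (S x) := fun x hx => by
    simp only [hT, projIcc_of_mem hℓ.le hx]
  have hTl : LipschitzWith K T := by
    refine LipschitzWith.of_dist_le_mul fun x y => ?_
    simp only [hT, dist_matrixCLM]
    refine (hS.dist_le_mul _ (projIcc 0 ℓ hℓ.le x).2 _ (projIcc 0 ℓ hℓ.le y).2).trans ?_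
    gcongr
    have := (LipschitzWith.projIcc hℓ.le).dist_le_mul x y
    simpa [Subtype.dist_eq] using this
  set v : ℝ → EdgeVec k := fun x => w 0 + ∫ t in (0 : ℝ)..x, g t with hv
  have hvw : ∀ x ∈ Icc 0 ℓ, w x = v x := fun x hx => hw.eq_add_integral hℓ hu hx
  have hgi := intervalIntegrable_edge hℓ.le g
  have hvac : AbsolutelyContinuousOnInterval v 0 ℓ :=
    absolutelyContinuousOnInterval_of_dist_le
      (absolutelyContinuousOnInterval_integral hgi left_mem_uIcc) fun x _ y _ => by
        simp only [hv, dist_add_left, le_refl]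
  have hvd : ∀ᵐ x, x ∈ uIcc 0 ℓ → HasDerivAt v (g x) x := by
    filter_upwards [hgi.ae_hasDerivAt_integral] with x hx hxm
    exact (hx hxm 0 left_mem_uIcc).const_add _
  have huv : u =ᵐ[edgeMeasure ℓ] v := by
    filter_upwards [hw.2, ae_restrict_mem measurableSet_Ioo] with x h1 h2
    rw [h1, hvw x (Ioo_subset_Icc_self h2)]
  have hae : (fun x => inner ℂ (u x) (h x)) =ᵐ[edgeMeasure ℓ]
      fun x => inner ℂ (v x) (T x (g x)) := by
    filter_upwards [huv, hh, ae_restrict_mem measurableSet_Ioo] with x h1 h2 h3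
    rw [h1, h2, hTx x (Ioo_subset_Icc_self h3)]
  have hi : Integrable (fun x => inner ℂ (u x) (h x)) (edgeMeasure ℓ) := L2.integrable_inner u h
  have key := abs_two_mul_integral_sub_le (g := g) hℓ.le hTl (fun x a b => by
    rw [inner_matrixCLM_comm (hH _ (projIcc 0 ℓ hℓ.le x).2)]) hvac hvd (hi.congr hae).re
  have e1 : ∫ x in Ioo 0 ℓ, (inner ℂ (v x) (T x (g x))).re = (inner ℂ u h).re := by
    rw [L2.inner_def, integral_congr_ae hae]
    exact integral_re (hi.congr hae)
  have e2 : ∫ x in Ioo 0 ℓ, ‖v x‖ ^ 2 = ‖u‖ ^ 2 := by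
    rw [← integral_norm_sq_edge]
    refine integral_congr_ae ?_
    filter_upwards [huv] with x hx
    rw [hx]
  have m0 : (0 : ℝ) ∈ Icc 0 ℓ := left_mem_Icc.2 hℓ.le
  have m1 : ℓ ∈ Icc 0 ℓ := right_mem_Icc.2 hℓ.le
  rwa [e1, e2, hTx 0 m0, hTx ℓ m1, ← hvw 0 m0, ← hvw ℓ m1] at key

end EdgeL2Energy

/-! ### Multiplication operators -/

section Multiplication

variable {ℓ : ℝ} {k : ℕ} {A B : ℝ → Matrix (Fin k) (Fin k) ℂ}

theorem coeFn_mulLp (hA : MemLp A ∞ (edgeMeasure ℓ)) (u : EdgeL2 ℓ k) :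
    mulLp A hA u =ᵐ[edgeMeasure ℓ] fun x => matrixCLM k (A x) (u x) :=
  (memLp_mulVec hA u).coeFn_toLp

theorem norm_mulLp_le (hA : MemLp A ∞ (edgeMeasure ℓ)) (u : EdgeL2 ℓ k) :
    ‖mulLp A hA u‖ ≤ (eLpNorm A ∞ (edgeMeasure ℓ)).toReal * ‖u‖ := by
  refine Lp.norm_le_mul_norm_of_ae_le_mul ?_
  filter_upwards [coeFn_mulLp hA u, ae_le_eLpNormEssSup (f := A) (μ := edgeMeasure ℓ)] with x h1 h2
  have h3 : ‖A x‖ ≤ (eLpNorm A ∞ (edgeMeasure ℓ)).toReal := by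
    rw [eLpNorm_exponent_top, ← toReal_enorm]
    exact ENNReal.toReal_mono (by rw [← eLpNorm_exponent_top]; exact hA.2.ne) h2
  rw [h1]
  exact (Matrix.l2_opNorm_mulVec (A x) (u x)).trans
    (mul_le_mul_of_nonneg_right h3 (norm_nonneg _))

/-- Multiplication by a bounded matrix-valued function, as a bounded operator. -/
def mulCLM (A : ℝ → Matrix (Fin k) (Fin k) ℂ) (hA : MemLp A ∞ (edgeMeasure ℓ)) :
    EdgeL2 ℓ k →L[ℂ] EdgeL2 ℓ k :=
  (mulLp A hA).mkContinuous _ (norm_mulLp_le hA)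

theorem matrixCLM_mul_apply (A B : Matrix (Fin k) (Fin k) ℂ) (x : EdgeVec k) :
    matrixCLM k A (matrixCLM k B x) = matrixCLM k (A * B) x := by
  simp only [matrixCLM_apply, Matrix.mulVec_mulVec]

theorem mulLp_mulLp_of_mul_eq_one (hA : MemLp A ∞ (edgeMeasure ℓ)) (hB : MemLp B ∞ (edgeMeasure ℓ))
    (h : ∀ x ∈ Ioo 0 ℓ, A x * B x = 1) (u : EdgeL2 ℓ k) : mulLp A hA (mulLp B hB u) = u := by
  refine Lp.ext ?_
  filter_upwards [coeFn_mulLp hA (mulLp B hB u), coeFn_mulLp hB u,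
    ae_restrict_mem measurableSet_Ioo] with x h1 h2 h3
  rw [h1, h2, matrixCLM_mul_apply, h x h3, matrixCLM_apply, Matrix.one_mulVec]

theorem inner_mulLp_comm (hA : MemLp A ∞ (edgeMeasure ℓ))
    (hH : ∀ x ∈ Ioo 0 ℓ, (A x).IsHermitian) (u v : EdgeL2 ℓ k) :
    inner ℂ (mulLp A hA u) v = inner ℂ u (mulLp A hA v) := by
  rw [L2.inner_def, L2.inner_def]
  refine integral_congr_ae ?_
  filter_upwards [coeFn_mulLp hA u, coeFn_mulLp hA v, ae_restrict_mem measurableSet_Ioo]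
    with x h1 h2 h3
  rw [h1, h2, inner_matrixCLM_comm (hH x h3)]

theorem inner_mulLp_eq (hA : MemLp A ∞ (edgeMeasure ℓ)) (u v : EdgeL2 ℓ k) :
    inner ℂ v (mulLp A hA u) = ∫ x in Ioo 0 ℓ, (A x *ᵥ (u x).ofLp) ⬝ᵥ star (v x).ofLp := by
  rw [L2.inner_def]
  refine integral_congr_ae ?_
  filter_upwards [coeFn_mulLp hA u] with x h1
  rw [h1, inner_matrixCLM]

theorem le_re_inner_mulLp (hA : MemLp A ∞ (edgeMeasure ℓ)) {q : ℝ}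
    (hq : ∀ x ∈ Icc 0 ℓ, ∀ ξ : EdgeVec k, q * ‖ξ‖ ^ 2 ≤ ((A x *ᵥ ξ.ofLp) ⬝ᵥ star ξ.ofLp).re)
    (u : EdgeL2 ℓ k) : q * ‖u‖ ^ 2 ≤ (inner ℂ u (mulLp A hA u)).re := by
  have hi : Integrable (fun x => inner ℂ (u x) (mulLp A hA u x)) (edgeMeasure ℓ) :=
    L2.integrable_inner u (mulLp A hA u)
  have hn : Integrable (fun x => ‖u x‖ ^ 2) (edgeMeasure ℓ) := (Lp.memLp u).integrable_norm_pow (by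
    norm_num)
  have e : (inner ℂ u (mulLp A hA u)).re =
      ∫ x in Ioo 0 ℓ, (inner ℂ (u x) (mulLp A hA u x)).re := by
    rw [L2.inner_def]
    exact (integral_re hi).symm
  rw [e, ← integral_norm_sq_edge, ← integral_const_mul]
  refine integral_mono_ae (hn.const_mul q) hi.re ?_
  filter_upwards [coeFn_mulLp hA u, ae_restrict_mem measurableSet_Ioo] with x h1 h2
  have := hq x (Ioo_subset_Icc_self h2) (u x)
  rw [h1, inner_matrixCLM]
  exact this

theorem memLp_top_inv (hc : ContinuousOn A (Icc 0 ℓ)) (hu : ∀ x ∈ Icc 0 ℓ, IsUnit (A x)) :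
    MemLp (fun x => (A x)⁻¹) ∞ (edgeMeasure ℓ) := by
  have hci : ContinuousOn (fun x => (A x)⁻¹) (Icc 0 ℓ) := by
    intro x hx
    obtain ⟨a, ha⟩ := hu x hx
    have h1 := NormedRing.inverse_continuousAt a
    rw [ha] at h1
    simp only [Matrix.nonsing_inv_eq_ringInverse]
    exact h1.comp_continuousWithinAt (hc x hx)
  obtain ⟨C, hC⟩ := isCompact_Icc.exists_bound_of_continuousOn hci
  refine memLp_top_of_bound
    ((hci.mono Ioo_subset_Icc_self).aestronglyMeasurable measurableSet_Ioo) C ?_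
  exact (ae_restrict_iff' measurableSet_Ioo).2 (Eventually.of_forall fun x hx =>
    hC x (Ioo_subset_Icc_self hx))

theorem exists_lipschitzOnWith_mul {s : Set ℝ} (hs : IsCompact s)
    (hA : ∃ K : ℝ≥0, LipschitzOnWith K A s) (hB : ∃ K : ℝ≥0, LipschitzOnWith K B s) :
    ∃ K : ℝ≥0, LipschitzOnWith K (fun x => A x * B x) s := by
  obtain ⟨KA, hA⟩ := hA
  obtain ⟨KB, hB⟩ := hB
  obtain ⟨a, ha⟩ := hs.exists_bound_of_continuousOn hA.continuousOn
  obtain ⟨b, hb⟩ := hs.exists_bound_of_continuousOn hB.continuousOn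
  refine ⟨KA * b.toNNReal + a.toNNReal * KB, LipschitzOnWith.of_dist_le_mul fun x hx y hy => ?_⟩
  have h1 := hA.dist_le_mul x hx y hy
  have h2 := hB.dist_le_mul x hx y hy
  rw [dist_eq_norm] at h1 h2 ⊢
  have e : A x * B x - A y * B y = (A x - A y) * B x + A y * (B x - B y) := by noncomm_ring
  have hb' : ‖B x‖ ≤ b.toNNReal := (hb x hx).trans (Real.le_coe_toNNReal b)
  have ha' : ‖A y‖ ≤ a.toNNReal := (ha y hy).trans (Real.le_coe_toNNReal a)
  rw [e]
  calc ‖(A x - A y) * B x + A y * (B x - B y)‖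
      ≤ ‖A x - A y‖ * ‖B x‖ + ‖A y‖ * ‖B x - B y‖ :=
        (norm_add_le _ _).trans (add_le_add (norm_mul_le _ _) (norm_mul_le _ _))
    _ ≤ (KA * dist x y) * b.toNNReal + a.toNNReal * (KB * dist x y) := by gcongr
    _ = _ := by push_cast; ring

end Multiplication

/-! ### Edgewise operators on the network -/

section Diagonal

variable {V E : Type*} {G : Network V E} {k : E → ℕ}

/-- The operator on `⨁_e L²(0, ℓ_e)^{k_e}` that acts by `T e` on the edge `e`. -/
def diagCLM (T : ∀ e, EdgeL2 (G.len e) (k e) →L[ℂ] EdgeL2 (G.len e) (k e)) :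
    L2G G k →L[ℂ] L2G G k :=
  ((PiLp.continuousLinearEquiv 2 ℂ _).symm.toContinuousLinearMap.comp
    (ContinuousLinearMap.piMap T)).comp (PiLp.continuousLinearEquiv 2 ℂ _).toContinuousLinearMap

theorem diagCLM_apply (T : ∀ e, EdgeL2 (G.len e) (k e) →L[ℂ] EdgeL2 (G.len e) (k e))
    (u : L2G G k) (e : E) : diagCLM T u e = T e (u e) := rfl

theorem isCompactOperator_diagCLM [Fintype E] [DecidableEq E]
    {T : ∀ e, EdgeL2 (G.len e) (k e) →L[ℂ] EdgeL2 (G.len e) (k e)}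
    (hT : ∀ e, IsCompactOperator (T e)) : IsCompactOperator (diagCLM T) := by
  let ι : ∀ e, EdgeL2 (G.len e) (k e) →L[ℂ] L2G G k := fun e =>
    (PiLp.continuousLinearEquiv 2 ℂ _).symm.toContinuousLinearMap.comp
      (ContinuousLinearMap.single ℂ (fun e => EdgeL2 (G.len e) (k e)) e)
  let π : ∀ e, L2G G k →L[ℂ] EdgeL2 (G.len e) (k e) := fun e => PiLp.proj 2 _ e
  have hsum : diagCLM T = ∑ e, (ι e).comp ((T e).comp (π e)) := by
    ext1 u
    ext1 e
    rw [diagCLM_apply, sum_apply, WithLp.ofLp_sum, Finset.sum_apply,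
      Finset.sum_eq_single e]
    · exact (Pi.single_eq_same (M := fun e => EdgeL2 (G.len e) (k e)) e (T e (u e))).symm
    · intro e' _ he
      exact Pi.single_eq_of_ne (M := fun e => EdgeL2 (G.len e) (k e)) he.symm (T e' (u e'))
    · simp
  rw [hsum]
  exact (compactOperator (RingHom.id ℂ) (L2G G k) (L2G G k)).sum_mem (t := Finset.univ)
    (f := fun e => (ι e).comp ((T e).comp (π e))) fun e _ => ((hT e).comp_clm (π e)).clm_comp (ι e)

end Diagonal

/-! ### Vertex conditions -/

section VertexConditions

variable {V E : Type*} {G : Network V E} {k : E → ℕ}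

/-- The vector at the vertex `v` that collects given values at the ends of the edges. -/
def vertexTrace (G : Network V E) (k : E → ℕ) (v : V) :
    (∀ e, Bool → EdgeVec (k e)) →ₗ[ℂ] VertexVec G k v where
  toFun b := WithLp.toLp 2 fun p => b p.1.edge p.1.1.2 p.2
  map_add' _ _ := rfl
  map_smul' _ _ := rfl

theorem vertexValues_eq_vertexTrace (w : ∀ e, ℝ → EdgeVec (k e)) (v : V) :
    vertexValues G k w v = vertexTrace G k v fun e b => w e (G.coord e b) := rfl

/-- A vector on every edge, regarded as a constant function, at both ends of the edges. -/
def constEnds (k : E → ℕ) : (∀ e, EdgeVec (k e)) →ₗ[ℂ] (∀ e, Bool → EdgeVec (k e)) where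
  toFun K := fun e _ => K e
  map_add' _ _ := rfl
  map_smul' _ _ := rfl

/-- Values at the terminal ends of the edges, extended by zero to the initial ends. -/
def terminalEnds (k : E → ℕ) : (∀ e, EdgeVec (k e)) →ₗ[ℂ] (∀ e, Bool → EdgeVec (k e)) where
  toFun K := fun e b => if b then K e else 0
  map_add' K L := by
    funext e b
    cases b <;> simp
  map_smul' c K := by
    funext e b
    cases b <;> simp

variable [Fintype E] [DecidableEq V]

/-- Every end of an edge belongs to exactly one vertex. -/
theorem sum_incident [Fintype V] {M : Type*} [AddCommMonoid M] (f : E × Bool → M) :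
    ∑ v, ∑ h : G.Incident v, f h.1 = ∑ e, (f (e, true) + f (e, false)) := by
  rw [← Fintype.sum_sigma' (fun v (h : G.Incident v) => f h.1)]
  rw [Fintype.sum_equiv (Equiv.sigmaFiberEquiv fun p : E × Bool => G.endpoint p.1 p.2)
    (fun x => f x.2.1) f (fun x => rfl), Fintype.sum_prod_type]
  simp

/-- The extension by zero is the adjoint of taking the vertex values of edgewise constant functions;
adding the components at the two ends of a loop is what makes this true for loops. -/
theorem inner_extendByZero (v : V) (ξ : VertexVec G k v) (K : ∀ e, EdgeVec (k e)) :
    inner ℂ (extendByZero G k v ξ) (WithLp.toLp 2 fun p : Σ e : E, Fin (k e) => K p.1 p.2) =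
      inner ℂ ξ (vertexTrace G k v (constEnds k K)) := by
  have h1 : inner ℂ ξ (vertexTrace G k v (constEnds k K)) = ∑ h : G.Incident v, ∑ i,
      inner ℂ (ξ ⟨h, i⟩) (K h.edge i) := by
    rw [PiLp.inner_apply, Fintype.sum_sigma]
    rfl
  have h2 : inner ℂ (extendByZero G k v ξ)
      (WithLp.toLp 2 fun p : Σ e : E, Fin (k e) => K p.1 p.2) = ∑ e, ∑ b : Bool, ∑ i,
      inner ℂ (if h : G.endpoint e b = v then ξ ⟨⟨(e, b), h⟩, i⟩ else 0) (K e i) := by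
    rw [PiLp.inner_apply, Fintype.sum_sigma]
    refine Finset.sum_congr rfl fun e _ => ?_
    rw [Finset.sum_comm]
    refine Finset.sum_congr rfl fun i _ => ?_
    rw [← sum_inner]
    rfl
  rw [h1, h2, ← Fintype.sum_prod_type' (f := fun e b => ∑ i,
    inner ℂ (if h : G.endpoint e b = v then ξ ⟨⟨(e, b), h⟩, i⟩ else 0) (K e i))]
  rw [← Fintype.sum_subtype_add_sum_subtype (fun x : E × Bool => G.endpoint x.1 x.2 = v)]
  rw [Finset.sum_eq_zero (s := (Finset.univ : Finset {x : E × Bool // ¬G.endpoint x.1 x.2 = v}))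
    fun x _ => Finset.sum_eq_zero fun i _ => by rw [dif_neg x.2, inner_zero_left], add_zero]
  exact Finset.sum_congr rfl fun x _ => Finset.sum_congr rfl fun i _ => by rw [dif_pos x.2]

/-- The vertex values of an edgewise constant function modulo the vertex conditions. -/
def vertexDefect (G : Network V E) (k : E → ℕ) (Y : ∀ v : V, Submodule ℂ (VertexVec G k v)) :
    (∀ e, EdgeVec (k e)) →ₗ[ℂ] (∀ v, VertexVec G k v ⧸ Y v) :=
  LinearMap.pi fun v => (Y v).mkQ ∘ₗ vertexTrace G k v ∘ₗ constEnds k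

variable {Y : ∀ v : V, Submodule ℂ (VertexVec G k v)}

/-- Since the extensions by zero of the orthogonal complements span `ℂ^k`, there is no nonzero
edgewise constant function that satisfies the vertex conditions. -/
theorem vertexDefect_injective
    (h : Module.finrank ℂ (⨆ v, (Y v)ᗮ.map (extendByZero G k v) :
      Submodule ℂ (TotalVec k)) = ∑ e, k e) : Function.Injective (vertexDefect G k Y) := by
  have htop : (⨆ v, (Y v)ᗮ.map (extendByZero G k v) : Submodule ℂ (TotalVec k)) = ⊤ := by
    refine Submodule.eq_top_of_finrank_eq ?_
    rw [h, finrank_euclideanSpace, Fintype.card_sigma]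
    simp
  rw [← LinearMap.ker_eq_bot, Submodule.eq_bot_iff]
  intro K hK
  have hY : ∀ v, vertexTrace G k v (constEnds k K) ∈ Y v := fun v => by
    have := congrFun (LinearMap.mem_ker.1 hK) v
    exact (Submodule.Quotient.mk_eq_zero _).1 this
  set K' : TotalVec k := WithLp.toLp 2 fun p : Σ e : E, Fin (k e) => K p.1 p.2 with hK'
  have horth : (⨆ v, (Y v)ᗮ.map (extendByZero G k v) : Submodule ℂ (TotalVec k)) ≤ (ℂ ∙ K')ᗮ := by
    refine iSup_le fun v => ?_
    rintro _ ⟨ξ, hξ, rfl⟩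
    rw [Submodule.mem_orthogonal_singleton_iff_inner_left, hK', inner_extendByZero]
    exact (Submodule.mem_orthogonal' _ _).1 hξ _ (hY v)
  rw [htop, top_le_iff, Submodule.orthogonal_eq_top_iff, Submodule.span_singleton_eq_bot] at horth
  funext e
  ext i
  exact congrArg (fun z : TotalVec k => z ⟨e, i⟩) horth

variable [Fintype V]

/-- The total dimension of the quotients is `2 k - k`, because every edge has two ends. -/
theorem finrank_vertexQuotient (h : ∑ e, k e = ∑ v, Module.finrank ℂ (Y v)) :
    Module.finrank ℂ (∀ e, EdgeVec (k e)) = Module.finrank ℂ (∀ v, VertexVec G k v ⧸ Y v) := by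
  rw [Module.finrank_pi_fintype, Module.finrank_pi_fintype]
  have h1 : ∀ v, Module.finrank ℂ (VertexVec G k v ⧸ Y v) + Module.finrank ℂ (Y v) =
      ∑ h : G.Incident v, k h.1.1 := fun v => by
    rw [Submodule.finrank_quotient_add_finrank, finrank_euclideanSpace, Fintype.card_sigma]
    simp
  have h2 := Finset.sum_congr (rfl : (Finset.univ : Finset V) = Finset.univ) fun v _ => h1 v
  have h3 : ∑ v, ∑ h : G.Incident v, k h.1.1 = ∑ e, (k e + k e) :=
    sum_incident (G := G) fun p => k p.1
  rw [Finset.sum_add_distrib, ← h, h3, Finset.sum_add_distrib] at h2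
  simp only [finrank_euclideanSpace_fin]
  omega

/-- For arbitrary increments along the edges there are unique initial values such that the vertex
conditions hold; they depend linearly on the increments. -/
theorem exists_initialValues
    (hbasis₁ : Module.finrank ℂ (⨆ v, (Y v)ᗮ.map (extendByZero G k v) :
      Submodule ℂ (TotalVec k)) = ∑ e, k e)
    (hbasis₂ : ∑ e, k e = ∑ v, Module.finrank ℂ (Y v)) :
    ∃ σ : (∀ e, EdgeVec (k e)) →ₗ[ℂ] (∀ e, EdgeVec (k e)), ∀ K β,
      (∀ v, vertexTrace G k v (constEnds k K + terminalEnds k β) ∈ Y v) ↔ K = σ β := by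
  let Φ := LinearEquiv.ofInjectiveOfFinrankEq (vertexDefect G k Y) (vertexDefect_injective hbasis₁)
    (finrank_vertexQuotient hbasis₂)
  have hΦ : ∀ K, Φ K = vertexDefect G k Y K := fun K => rfl
  let J : (∀ e, EdgeVec (k e)) →ₗ[ℂ] (∀ v, VertexVec G k v ⧸ Y v) :=
    LinearMap.pi fun v => (Y v).mkQ ∘ₗ vertexTrace G k v ∘ₗ terminalEnds k
  refine ⟨-(Φ.symm.toLinearMap ∘ₗ J), fun K β => ?_⟩
  have h1 : (∀ v, vertexTrace G k v (constEnds k K + terminalEnds k β) ∈ Y v) ↔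
      Φ K + J β = 0 := by
    rw [funext_iff]
    refine forall_congr' fun v => ?_
    rw [map_add, ← Submodule.Quotient.mk_eq_zero]
    rfl
  rw [h1, add_eq_zero_iff_eq_neg, ← LinearEquiv.eq_symm_apply, map_neg]
  rfl

end VertexConditions

section VertexEnergy

variable {V E : Type*} [Fintype E] [DecidableEq V] [DecidableEq E]
  {G : Network V E} {k : E → ℕ} (S : HypSystem G k)

theorem HypSystem.q_vertexTrace (v : V) (b : ∀ e, Bool → EdgeVec (k e)) :
    S.q v (vertexTrace G k v b) = ∑ h : G.Incident v, h.sign *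
      inner ℂ (b h.1.1 h.1.2) (matrixCLM _ (S.Q h.1.1 (G.coord h.1.1 h.1.2) *
        S.M h.1.1 (G.coord h.1.1 h.1.2)) (b h.1.1 h.1.2)) := by
  rw [HypSystem.q, dotProduct, Fintype.sum_sigma]
  refine Finset.sum_congr rfl fun h _ => ?_
  rw [inner_matrixCLM, dotProduct, Finset.mul_sum]
  refine Finset.sum_congr rfl fun i _ => ?_
  have e : (S.T v *ᵥ (vertexTrace G k v b).ofLp) ⟨h, i⟩ =
      h.sign * ((S.Q h.1.1 (G.coord h.1.1 h.1.2) * S.M h.1.1 (G.coord h.1.1 h.1.2)) *ᵥ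
        (b h.1.1 h.1.2).ofLp) i := by
    rw [Matrix.mulVec, dotProduct, Fintype.sum_sigma, Finset.sum_eq_single h]
    · rw [Matrix.mulVec, dotProduct, Finset.mul_sum]
      refine Finset.sum_congr rfl fun j _ => ?_
      rw [HypSystem.T, Matrix.blockDiagonal'_apply_eq, Matrix.smul_apply, smul_eq_mul, mul_assoc]
      rfl
    · intro h' _ hne
      refine Finset.sum_eq_zero fun j _ => ?_
      rw [HypSystem.T, Matrix.blockDiagonal'_apply_ne _ _ _ hne.symm, zero_mul]
    · simp
  rw [e, mul_assoc]
  rfl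

/-- The boundary terms of all edges add up to the sum of the forms `q_v` over the vertices. -/
theorem HypSystem.sum_q_vertexValues [Fintype V] (w : ∀ e, ℝ → EdgeVec (k e)) :
    ∑ v, S.q v (vertexValues G k w v) = ∑ e,
      (inner ℂ (w e (G.len e)) (matrixCLM _ (S.Q e (G.len e) * S.M e (G.len e)) (w e (G.len e))) -
        inner ℂ (w e 0) (matrixCLM _ (S.Q e 0 * S.M e 0) (w e 0))) := by
  simp only [vertexValues_eq_vertexTrace, S.q_vertexTrace, Network.Incident.sign]
  rw [sum_incident (G := G) (fun p => (if p.2 then (1 : ℂ) else -1) *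
    inner ℂ (w p.1 (G.coord p.1 p.2)) (matrixCLM _ (S.Q p.1 (G.coord p.1 p.2) *
      S.M p.1 (G.coord p.1 p.2)) (w p.1 (G.coord p.1 p.2))))]
  refine Finset.sum_congr rfl fun e _ => ?_
  simp [Network.coord, sub_eq_add_neg]

end VertexEnergy

/-! ### Edgewise primitives -/

section EdgewisePrimitive

variable {V E : Type*} {G : Network V E} {k : E → ℕ}

/-- The functions on the network that are constant on every edge. -/
def constL2G (G : Network V E) (k : E → ℕ) : (∀ e, EdgeVec (k e)) →L[ℂ] L2G G k :=
  (PiLp.continuousLinearEquiv 2 ℂ _).symm.toContinuousLinearMap.comp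
    (ContinuousLinearMap.piMap fun e => Lp.constL 2 (edgeMeasure (G.len e)) ℂ)

/-- The increments `∫ g_e dx` along the edges. -/
def increments (G : Network V E) (k : E → ℕ) : L2G G k →L[ℂ] (∀ e, EdgeVec (k e)) :=
  (ContinuousLinearMap.piMap fun e => primitiveAt (G.len e) (k e) (G.len e)).comp
    (PiLp.continuousLinearEquiv 2 ℂ _).toContinuousLinearMap

theorem increments_apply (g : L2G G k) (e : E) :
    increments G k g e = ∫ t in (0 : ℝ)..G.len e, g e t :=
  primitiveAt_eq_intervalIntegral (g e) (right_mem_Icc.2 (G.len_pos e).le)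

theorem vertexValues_primitive (K : ∀ e, EdgeVec (k e)) (g : L2G G k) (v : V) :
    vertexValues G k (fun e x => K e + ∫ t in (0 : ℝ)..x, g e t) v =
      vertexTrace G k v (constEnds k K + terminalEnds k (increments G k g)) := by
  rw [vertexValues_eq_vertexTrace]
  congr 1
  funext e b
  cases b
  · simp [Network.coord, constEnds, terminalEnds]
  · simp [Network.coord, constEnds, terminalEnds, increments_apply]

theorem vertexValues_congr {w w' : ∀ e, ℝ → EdgeVec (k e)}
    (h : ∀ e, EqOn (w e) (w' e) (Icc 0 (G.len e))) (v : V) :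
    vertexValues G k w v = vertexValues G k w' v := by
  rw [vertexValues_eq_vertexTrace, vertexValues_eq_vertexTrace]
  congr 1
  funext e b
  refine h e ?_
  cases b
  · exact left_mem_Icc.2 (G.len_pos e).le
  · exact right_mem_Icc.2 (G.len_pos e).le

end EdgewisePrimitive

/-! ### The coefficients as operators on the network -/

section Operator

variable {V E : Type*} {G : Network V E} {k : E → ℕ}

theorem HypSystem.memLp_M (S : HypSystem G k) (e : E) : MemLp (S.M e) ∞ (edgeMeasure (G.len e)) :=
  memLp_top_of_lipschitz (S.M_lipschitz e)

theorem HypSystem.memLp_Q (S : HypSystem G k) (e : E) : MemLp (S.Q e) ∞ (edgeMeasure (G.len e)) :=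
  memLp_top_of_lipschitz (S.Q_lipschitz e)

theorem HypSystem.memLp_Minv (S : HypSystem G k) (e : E) :
    MemLp (fun x => (S.M e x)⁻¹) ∞ (edgeMeasure (G.len e)) :=
  memLp_top_inv (S.M_lipschitz e).choose_spec.continuousOn (S.M_isUnit e)

/-- Multiplication by `M` on the network. -/
def HypSystem.opM (S : HypSystem G k) : L2G G k →L[ℂ] L2G G k :=
  diagCLM fun e => mulCLM (S.M e) (S.memLp_M e)

/-- Multiplication by `N` on the network. -/
def HypSystem.opN (S : HypSystem G k) : L2G G k →L[ℂ] L2G G k :=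
  diagCLM fun e => mulCLM (S.N e) (S.N_memLp e)

/-- Multiplication by `Q` on the network, the Gram operator of the energy inner product. -/
def HypSystem.opQ (S : HypSystem G k) : L2G G k →L[ℂ] L2G G k :=
  diagCLM fun e => mulCLM (S.Q e) (S.memLp_Q e)

/-- Multiplication by `M⁻¹` on the network. -/
def HypSystem.opMinv (S : HypSystem G k) : L2G G k →L[ℂ] L2G G k :=
  diagCLM fun e => mulCLM (fun x => (S.M e x)⁻¹) (S.memLp_Minv e)

theorem HypSystem.opM_opMinv (S : HypSystem G k) (u : L2G G k) : S.opM (S.opMinv u) = u := by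
  ext1 e
  refine mulLp_mulLp_of_mul_eq_one (S.memLp_M e) (S.memLp_Minv e) (fun x hx => ?_) (u e)
  exact Matrix.mul_nonsing_inv _ ((Matrix.isUnit_iff_isUnit_det _).1
    (S.M_isUnit e x (Ioo_subset_Icc_self hx)))

theorem HypSystem.opMinv_opM (S : HypSystem G k) (u : L2G G k) : S.opMinv (S.opM u) = u := by
  ext1 e
  refine mulLp_mulLp_of_mul_eq_one (S.memLp_Minv e) (S.memLp_M e) (fun x hx => ?_) (u e)
  exact Matrix.nonsing_inv_mul _ ((Matrix.isUnit_iff_isUnit_det _).1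
    (S.M_isUnit e x (Ioo_subset_Icc_self hx)))

/-! ### The derivative under the vertex conditions and its inverse -/

variable {Y : ∀ v : V, Submodule ℂ (VertexVec G k v)}

theorem hasWeakDeriv_weakDeriv {ℓ : ℝ} {k : ℕ} (u : H1 ℓ k) :
    HasWeakDeriv ℓ u.1 (weakDeriv ℓ k u) :=
  u.2.choose_spec

/-- `u ∈ D(𝒜)` has the (weak) derivative `g`. -/
def IsDomainDeriv (Y : ∀ v : V, Submodule ℂ (VertexVec G k v)) (u g : L2G G k) : Prop :=
  (∀ e, HasWeakDeriv (G.len e) (u e) (g e)) ∧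
    ∃ w : ∀ e, ℝ → EdgeVec (k e), (∀ e, IsContRep (u e) (w e)) ∧ ∀ v, vertexValues G k w v ∈ Y v

theorem HypSystem.mem_graph_operator_iff (S : HypSystem G k) {u f : L2G G k} :
    (u, f) ∈ (S.operator Y).graph ↔ ∃ g, IsDomainDeriv Y u g ∧ f = S.opM g + S.opN u := by
  rw [LinearPMap.mem_graph_iff]
  constructor
  · rintro ⟨y, rfl, rfl⟩
    exact ⟨WithLp.toLp 2 fun e => weakDeriv (G.len e) (k e) ⟨y.1 e, y.2.1 e⟩,
      ⟨fun e => hasWeakDeriv_weakDeriv ⟨y.1 e, y.2.1 e⟩, y.2.2⟩, rfl⟩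
  · rintro ⟨g, ⟨h1, h2⟩, rfl⟩
    refine ⟨⟨u, fun e => ⟨g e, h1 e⟩, h2⟩, rfl, ?_⟩
    ext1 e
    have h3 : weakDeriv (G.len e) (k e) ⟨u e, ⟨g e, h1 e⟩⟩ = g e :=
      hasWeakDeriv_unique (hasWeakDeriv_weakDeriv _) (h1 e)
    change mulLp _ _ (weakDeriv (G.len e) (k e) ⟨u e, ⟨g e, h1 e⟩⟩) + mulLp _ _ (u e) = _
    rw [h3]
    rfl

variable [Fintype E]

/-- The primitive of `g` on the network with the initial values `σ β`, where `β` are the increments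
of the primitives along the edges. -/
def networkPrimitive (G : Network V E) (k : E → ℕ)
    (σ : (∀ e, EdgeVec (k e)) →ₗ[ℂ] (∀ e, EdgeVec (k e))) : L2G G k →L[ℂ] L2G G k :=
  diagCLM (fun e => volterra (G.len e) (k e)) +
    (constL2G G k).comp (σ.toContinuousLinearMap.comp (increments G k))

theorem networkPrimitive_apply (σ : (∀ e, EdgeVec (k e)) →ₗ[ℂ] (∀ e, EdgeVec (k e))) (g : L2G G k)
    (e : E) : networkPrimitive G k σ g e = volterra (G.len e) (k e) (g e) +
      Lp.constL 2 (edgeMeasure (G.len e)) ℂ (σ (increments G k g) e) := rfl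

theorem isCompactOperator_networkPrimitive [DecidableEq E]
    (σ : (∀ e, EdgeVec (k e)) →ₗ[ℂ] (∀ e, EdgeVec (k e))) :
    IsCompactOperator (networkPrimitive G k σ) :=
  (isCompactOperator_diagCLM fun e => isCompactOperator_volterra (G.len_pos e)).add
    ((isCompactOperator_of_finiteDimensional _).clm_comp (constL2G G k))

variable {σ : (∀ e, EdgeVec (k e)) →ₗ[ℂ] (∀ e, EdgeVec (k e))}

theorem isDomainDeriv_networkPrimitive (hσ : ∀ K β,
      (∀ v, vertexTrace G k v (constEnds k K + terminalEnds k β) ∈ Y v) ↔ K = σ β)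
    (g : L2G G k) : IsDomainDeriv Y (networkPrimitive G k σ g) g := by
  refine ⟨fun e => hasWeakDeriv_volterra (G.len_pos e).le (g e) _,
    fun e x => σ (increments G k g) e + ∫ t in (0 : ℝ)..x, g e t,
    fun e => isContRep_volterra (G.len_pos e).le (g e) _, fun v => ?_⟩
  rw [vertexValues_primitive]
  exact (hσ _ _).2 rfl v

/-- A function in the domain is recovered from its derivative, as its initial values are determined
by the vertex conditions. -/
theorem networkPrimitive_of_isDomainDeriv (hσ : ∀ K β,
      (∀ v, vertexTrace G k v (constEnds k K + terminalEnds k β) ∈ Y v) ↔ K = σ β)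
    {u g : L2G G k} (h : IsDomainDeriv Y u g) : networkPrimitive G k σ g = u := by
  obtain ⟨hu, w, hw, hY⟩ := h
  have hw' : ∀ e, EqOn (w e) (fun x => w e 0 + ∫ t in (0 : ℝ)..x, g e t) (Icc 0 (G.len e)) :=
    fun e x hx => (hw e).eq_add_integral (G.len_pos e) (hu e) hx
  have hK : (fun e => w e 0) = σ (increments G k g) := by
    refine (hσ _ _).1 fun v => ?_
    rw [← vertexValues_primitive, ← vertexValues_congr hw']
    exact hY v
  ext1 e
  rw [networkPrimitive_apply, ← hK]
  refine Lp.ext ?_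
  filter_upwards [coeFn_volterra_add_const (g e) (w e 0), (hw e).2,
    ae_restrict_mem measurableSet_Ioo] with x h1 h2 h3
  rw [h1, h2]
  exact (hw' e (Ioo_subset_Icc_self h3)).symm

/-! ### The energy estimate on the network -/

theorem HypSystem.energyInner_eq (S : HypSystem G k) (u v : L2G G k) :
    S.energyInner u v = inner ℂ v (S.opQ u) := by
  rw [PiLp.inner_apply]
  exact Finset.sum_congr rfl fun e _ =>
    (inner_mulLp_eq (S.memLp_Q e) (u e) (v e)).symm

theorem HypSystem.inner_opQ_comm (S : HypSystem G k) (u v : L2G G k) :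
    inner ℂ (S.opQ u) v = inner ℂ u (S.opQ v) := by
  rw [PiLp.inner_apply, PiLp.inner_apply]
  exact Finset.sum_congr rfl fun e _ => inner_mulLp_comm (S.memLp_Q e)
    (fun x hx => S.Q_isHermitian e x (Ioo_subset_Icc_self hx)) (u e) (v e)

theorem HypSystem.exists_le_inner_opQ (S : HypSystem G k) :
    ∃ m : ℝ, 0 < m ∧ ∀ u : L2G G k, m * ‖u‖ ^ 2 ≤ (inner ℂ (S.opQ u) u).re := by
  choose q hq0 hq using S.Q_pos
  obtain ⟨M, hM⟩ := Finite.exists_le fun e => (q e)⁻¹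
  have hM0 : 0 < max M 1 := lt_max_of_lt_right one_pos
  refine ⟨(max M 1)⁻¹, by positivity, fun u => ?_⟩
  have hle : ∀ e, (max M 1)⁻¹ ≤ q e := fun e => by
    rw [inv_le_comm₀ hM0 (hq0 e)]
    exact (hM e).trans (le_max_left _ _)
  rw [S.inner_opQ_comm, PiLp.inner_apply, Complex.re_sum, PiLp.norm_sq_eq_of_L2, Finset.mul_sum]
  refine Finset.sum_le_sum fun e _ => ?_
  refine (mul_le_mul_of_nonneg_right (hle e) (by positivity)).trans ?_
  exact le_re_inner_mulLp (S.memLp_Q e) (hq e) (u e)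

variable [DecidableEq V] [DecidableEq E] [Fintype V]

/-- Total isotropy of the vertex conditions makes the boundary terms cancel, which leaves the
terms of order zero. -/
theorem HypSystem.exists_energy_le (S : HypSystem G k) (hY : ∀ v, S.TotallyIsotropic v (Y v)) :
    ∃ c : ℝ, 0 ≤ c ∧ ∀ u f, (u, f) ∈ (S.operator Y).graph →
      |(inner ℂ (S.opQ f) u).re| ≤ c * ‖u‖ ^ 2 := by
  choose K hK using fun e => exists_lipschitzOnWith_mul isCompact_Icc (S.Q_lipschitz e)
    (S.M_lipschitz e)
  obtain ⟨L, hL⟩ := Finite.exists_le K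
  refine ⟨L / 2 + ‖S.opQ‖ * ‖S.opN‖, by positivity, fun u f huf => ?_⟩
  obtain ⟨g, ⟨hg, w, hw, hwY⟩, rfl⟩ := S.mem_graph_operator_iff.1 huf
  have hedge : ∀ e, |2 * (inner ℂ (u e) (S.opQ (S.opM g) e)).re -
      ((inner ℂ (w e (G.len e)) (matrixCLM _ (S.Q e (G.len e) * S.M e (G.len e))
        (w e (G.len e)))).re - (inner ℂ (w e 0) (matrixCLM _ (S.Q e 0 * S.M e 0) (w e 0))).re)| ≤
      K e * ‖u e‖ ^ 2 := fun e => by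
    refine abs_two_mul_inner_sub_le (G.len_pos e) (hK e) (S.QM_isHermitian e) (hg e) (hw e) ?_
    filter_upwards [coeFn_mulLp (S.memLp_Q e) (S.opM g e),
      coeFn_mulLp (S.memLp_M e) (g e)] with x h1 h2
    rw [← matrixCLM_mul_apply, ← h2]
    exact h1
  have hsum : ∑ e, ((inner ℂ (w e (G.len e)) (matrixCLM _ (S.Q e (G.len e) * S.M e (G.len e))
        (w e (G.len e)))).re - (inner ℂ (w e 0) (matrixCLM _ (S.Q e 0 * S.M e 0) (w e 0))).re) =
      0 := by
    have h := congrArg Complex.re (S.sum_q_vertexValues w)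
    rw [Finset.sum_eq_zero fun v _ => hY v _ (hwY v), Complex.re_sum] at h
    simpa using h.symm
  have h1 : |2 * (inner ℂ u (S.opQ (S.opM g))).re| ≤ L * ‖u‖ ^ 2 := by
    have e : 2 * (inner ℂ u (S.opQ (S.opM g))).re =
        ∑ e, (2 * (inner ℂ (u e) (S.opQ (S.opM g) e)).re -
          ((inner ℂ (w e (G.len e)) (matrixCLM _ (S.Q e (G.len e) * S.M e (G.len e))
          (w e (G.len e)))).re -
            (inner ℂ (w e 0) (matrixCLM _ (S.Q e 0 * S.M e 0) (w e 0))).re)) := by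
      rw [Finset.sum_sub_distrib, hsum, sub_zero, ← Finset.mul_sum, ← Complex.re_sum,
        PiLp.inner_apply]
    rw [e, PiLp.norm_sq_eq_of_L2, Finset.mul_sum]
    refine (Finset.abs_sum_le_sum_abs _ _).trans (Finset.sum_le_sum fun e _ => (hedge e).trans ?_)
    have : (K e : ℝ) ≤ L := hL e
    gcongr
  have h2 : |(inner ℂ u (S.opQ (S.opN u))).re| ≤ ‖S.opQ‖ * ‖S.opN‖ * ‖u‖ ^ 2 := by
    calc |(inner ℂ u (S.opQ (S.opN u))).re| ≤ ‖u‖ * ‖S.opQ (S.opN u)‖ :=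
          (Complex.abs_re_le_norm _).trans (norm_inner_le_norm _ _)
      _ ≤ ‖u‖ * (‖S.opQ‖ * (‖S.opN‖ * ‖u‖)) := by
          gcongr
          exact (S.opQ.le_opNorm _).trans (by gcongr; exact S.opN.le_opNorm _)
      _ = _ := by ring
  have e : (inner ℂ (S.opQ (S.opM g + S.opN u)) u).re =
      (inner ℂ u (S.opQ (S.opM g))).re + (inner ℂ u (S.opQ (S.opN u))).re := by
    rw [← inner_conj_symm, Complex.conj_re, map_add, inner_add_right, Complex.add_re]
  rw [e]
  refine (abs_add_le _ _).trans ?_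
  rw [abs_mul, abs_two] at h1
  linarith

end Operator

/-! ### Quasi-m-dissipativity from energy estimates -/

section Dissipative

variable {H : Type*} [NormedAddCommGroup H] [InnerProductSpace ℂ H] {A : H →ₗ.[ℂ] H}
  {P : H →L[ℂ] H} {m c : ℝ}

/-- The energy estimate excludes real eigenvalues of large modulus. -/
theorem mem_resolventSet_of_energy (hm : 0 < m)
    (hPm : ∀ x, m * ‖x‖ ^ 2 ≤ (inner ℂ (P x) x).re)
    (hA : ∀ u g, (u, g) ∈ A.graph → |(inner ℂ (P g) u).re| ≤ c * ‖u‖ ^ 2)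
    (hF : ∀ μ, μ ∉ pointSpectrum A → μ ∈ resolventSet A) {l : ℝ} (hl : c / m < |l|) :
    (l : ℂ) ∈ resolventSet A := by
  refine hF _ ?_
  rintro ⟨u, hu, hAu⟩
  have h1 := hA u _ (A.mem_graph u)
  rw [hAu, map_smul, inner_smul_left, Complex.conj_ofReal, Complex.re_ofReal_mul, abs_mul] at h1
  have h2 := hPm u
  have h3 : 0 < ‖(u : H)‖ ^ 2 := by positivity
  have h4 : c < |l| * m := (div_lt_iff₀ hm).1 hl
  have h5 : |l| * (m * ‖(u : H)‖ ^ 2) ≤ c * ‖(u : H)‖ ^ 2 :=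
    (mul_le_mul_of_nonneg_left (h2.trans (le_abs_self _)) (abs_nonneg _)).trans h1
  nlinarith

/-- An energy estimate together with the existence of the resolvent at all large real
points means quasi-m-dissipativity. -/
theorem isQuasiMDissipative_of_energy {B : H → H → ℂ} (hB : ∀ u v, B u v = inner ℂ v (P u))
    (hm : 0 < m) (hc : 0 ≤ c) (hPm : ∀ x, m * ‖x‖ ^ 2 ≤ (inner ℂ (P x) x).re)
    (hA : ∀ u g, (u, g) ∈ A.graph → |(inner ℂ (P g) u).re| ≤ c * ‖u‖ ^ 2)
    (hR : ∀ l : ℝ, c / m < l → ∀ f, ∃ u : A.domain, (l : ℂ) • (u : H) - A u = f) :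
    IsQuasiMDissipative B A := by
  refine ⟨c / m, fun u => ?_, fun μ hμ f => ?_⟩
  · have h1 := (abs_le.1 (hA u _ (A.mem_graph u))).2
    have h2 := hPm u
    rw [hB, ← inner_conj_symm, Complex.conj_re, map_sub, map_smul, inner_sub_left, inner_smul_left,
      Complex.conj_ofReal, Complex.sub_re, Complex.re_ofReal_mul]
    have h3 : c / m * (m * ‖(u : H)‖ ^ 2) ≤ c / m * (inner ℂ (P u) (u : H)).re :=
      mul_le_mul_of_nonneg_left h2 (by positivity)
    have h4 : c / m * (m * ‖(u : H)‖ ^ 2) = c * ‖(u : H)‖ ^ 2 := by field_simp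
    linarith
  · obtain ⟨u, hu⟩ := hR (μ + c / m) (by linarith) f
    refine ⟨u, ?_⟩
    rw [← hu, Complex.ofReal_add, add_smul]
    abel

end Dissipative

end HypNet

end

theorem mainTheorem1 {V E : Type*} [Fintype V] [Fintype E] [DecidableEq V] [DecidableEq E]
    (G : HypNet.Network V E) (k : E → ℕ) (S : HypNet.HypSystem G k)
    (Y : ∀ v : V, Submodule ℂ (HypNet.VertexVec G k v))
    (hY : ∀ v, S.TotallyIsotropic v (Y v))
    (hbasis₁ : Module.finrank ℂ (⨆ v, (Y v)ᗮ.map (HypNet.extendByZero G k v) :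
      Submodule ℂ (HypNet.TotalVec k)) = ∑ e, k e)
    (hbasis₂ : ∑ e, k e = ∑ v, Module.finrank ℂ (Y v)) :
    HypNet.IsQuasiMDissipative S.energyInner (S.operator Y) ∧
      HypNet.IsQuasiMDissipative S.energyInner (-(S.operator Y)) ∧
      HypNet.GeneratesC0Semigroup (S.operator Y) ∧
      HypNet.GeneratesC0Semigroup (-(S.operator Y)) ∧
      HypNet.GeneratesC0Group (S.operator Y) ∧
      HypNet.HasCompactResolvent (S.operator Y) ∧
      HypNet.HasPurePointSpectrum (S.operator Y) := by
  obtain ⟨σ, hσ⟩ := HypNet.exists_initialValues hbasis₁ hbasis₂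
  obtain ⟨m, hm, hPm⟩ := S.exists_le_inner_opQ
  obtain ⟨c, hc, hA⟩ := S.exists_energy_le hY
  -- The compact operator `K` inverts `M ∂`, that is, `𝒜` without the term `N`.
  set K := (HypNet.networkPrimitive G k σ).comp S.opMinv with hKdef
  have hK : IsCompactOperator K := by
    rw [hKdef, ContinuousLinearMap.coe_comp]
    exact (HypNet.isCompactOperator_networkPrimitive σ).comp_clm S.opMinv
  have hKr : ∀ f, (K f, f + S.opN (K f)) ∈ (S.operator Y).graph := fun f =>
    S.mem_graph_operator_iff.2 ⟨S.opMinv f, HypNet.isDomainDeriv_networkPrimitive hσ _, by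
      rw [S.opM_opMinv]⟩
  have hKl : ∀ u g, (u, g) ∈ (S.operator Y).graph → K (g - S.opN u) = u := fun u g hug => by
    obtain ⟨u', hu', rfl⟩ := S.mem_graph_operator_iff.1 hug
    rw [add_sub_cancel_right, hKdef, ContinuousLinearMap.comp_apply, S.opMinv_opM]
    exact HypNet.networkPrimitive_of_isDomainDeriv hσ hu'
  have hF : ∀ μ, μ ∉ HypNet.pointSpectrum (S.operator Y) →
      μ ∈ HypNet.resolventSet (S.operator Y) := fun μ hμ =>
    HypNet.mem_resolventSet_of_notMem_pointSpectrum hK hKr hμ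
  have hR : ∀ l : ℝ, c / m < |l| → (l : ℂ) ∈ HypNet.resolventSet (S.operator Y) := fun l hl =>
    HypNet.mem_resolventSet_of_energy hm hPm hA hF hl
  obtain ⟨T, hT, hTg⟩ := HypNet.exists_group_of_energy S.inner_opQ_comm hm hPm hc hA hR
  obtain ⟨h1, h2, h3⟩ := HypNet.generates_of_exists_group hT hTg
  refine ⟨?_, ?_, h1, h2, h3, ⟨⟨_, hR (c / m + 1) ?_⟩, fun μ R hμ => ?_⟩, ?_⟩
  · refine HypNet.isQuasiMDissipative_of_energy S.energyInner_eq hm hc hPm hA fun l hl f => ?_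
    obtain ⟨R, hR⟩ := hR l (hl.trans_le (le_abs_self l))
    obtain ⟨u, -, hu⟩ := hR.1 f
    exact ⟨u, hu⟩
  · refine HypNet.isQuasiMDissipative_of_energy S.energyInner_eq hm hc hPm (fun u g hug => ?_)
      fun l hl f => ?_
    · simpa using hA u (-g) (HypNet.mem_graph_neg_iff.1 hug)
    · obtain ⟨R, hR⟩ := hR (-l) (by rw [abs_neg]; exact hl.trans_le (le_abs_self l))
      obtain ⟨u, -, hu⟩ := hR.1 (-f)
      refine ⟨u, ?_⟩
      rw [LinearPMap.neg_apply, ← neg_eq_iff_eq_neg.2 hu]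
      push_cast
      rw [neg_smul]
      abel
  · rw [abs_of_pos (by positivity)]
    linarith
  · exact HypNet.isCompactOperator_of_isResolventAt hK hKl hμ
  · ext μ
    exact ⟨fun h => by_contra fun h' => h (hF μ h'),
      HypNet.notMem_resolventSet_of_mem_pointSpectrum⟩
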